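/- Let $d\ge 1$, $Q=[0,1]^d$ and $U(x)=(x_1+\dots+x_d)/\sqrt d$ for $x\in Q$. Let $\gamma_d=\int_{\mathbb S^{d-1}}|\sigma\cdot e|\,d\sigma$ for a unit vector $e\in\mathbb R^d$ (the value does not depend on $e$; for $d=1$ it is $2$). Let $\mathcal A$ be the set of all functions $\varphi:[0,\infty)\to[0,\infty)$ such that: - $\varphi$ is continuous on $[0,\infty)$ except at a finite number of points of $(0,\infty)$, where it has limits from the left and from the right; $\varphi(0)=0$; and $\varphi(t)=\min\{\varphi(t+),\varphi(t-)\}$ for all $t>0$; - $\varphi(t)\le a t^2$ on $[0,1]$ for some constant $a>0$, and $\varphi(t)\le b$ on $[0,\infty)$ for some constant $b>0$; - $\varphi$ is non-decreasing; - $\gamma_d\int_0^\infty \varphi(t)\,t^{-2}\,dt=1$. For $\varphi:[0,\infty)\to[0,\infty)$, a measurable $u:Q\to\mathbb R$ and $\delta>0$ put $$\Lambda_\delta(u,\varphi,Q)=\delta\int_Q\int_Q\frac{\varphi(|u(x)-u(y)|/\delta)}{|x-y|^{d+1}}\,dx\,dy\in[0,\infty],$$ and define $$\kappa(\varphi)=\inf\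 \liminf_{\delta\to0^+}\Lambda_\delta(v_\delta,\varphi,Q),$$ where the infimum is over all families $(v_\delta)_{\delta\in(0,1)}\subset L^1(Q)$ with $v_\delta\to U$ in $L^1(Q)$ as $\delta\to0^+$. Let $\tilde\varphi_1(t)=0$ for $0\le t\le 1$ and $\tilde\varphi_1(t)=1$ for $t>1$, and let $c_1=1/\gamma_d$ be the constant for which $c_1\tilde\varphi_1\in\mathcal A$. **Theorem.** For every $\varphi\in\mathcal A$ one has $\kappa(\varphi)\ge\kappa(c_1\tilde\varphi_1)$. Moreover, $$\inf_{\varphi\in\mathcal A}\kappa(\varphi)>0.$$ -/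

import Mathlib

open MeasureTheory Set Filter Topology
open scoped NNReal ENNReal

noncomputable section

namespace NonlocalTV

/-- `Λ(u, φ, Ω) = ∫_Ω ∫_Ω φ(|u(x) - u(y)|) / |x - y|^(d+1) dx dy`, with values in `[0, ∞]`. -/
def Lam {d : ℕ} (φ : ℝ≥0 → ℝ≥0) (Ω : Set (EuclideanSpace ℝ (Fin d)))
    (u : EuclideanSpace ℝ (Fin d) → ℝ) : ℝ≥0∞ :=
  ∫⁻ x in Ω, ∫⁻ y in Ω, (φ ‖u x - u y‖₊ : ℝ≥0∞) / edist x y ^ (d + 1)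

/-- `Λ_δ(u, φ, Ω) = δ Λ(u / δ, φ, Ω)`. -/
def LamDelta {d : ℕ} (φ : ℝ≥0 → ℝ≥0) (Ω : Set (EuclideanSpace ℝ (Fin d))) (δ : ℝ)
    (u : EuclideanSpace ℝ (Fin d) → ℝ) : ℝ≥0∞ :=
  ENNReal.ofReal δ * Lam φ Ω (fun x => u x / δ)

/-- `γ_d = ∫_{S^(d-1)} |σ · e| dσ` for the surface measure of the unit sphere and a unit vector `e`;
we take `e` to be the first vector of the standard basis (by rotation invariance the value does not
depend on that choice). For `d = 1` the surface measure is the counting measure on `{-1, 1}`. -/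
def gammaConst (d : ℕ) [NeZero d] : ℝ≥0∞ :=
  ∫⁻ σ : Metric.sphere (0 : EuclideanSpace ℝ (Fin d)) 1,
    ‖inner ℝ (σ : EuclideanSpace ℝ (Fin d)) (EuclideanSpace.single (0 : Fin d) (1 : ℝ))‖ₑ
    ∂(volume : Measure (EuclideanSpace ℝ (Fin d))).toSphere

/-- The class `𝒜` of admissible functions `φ : [0, ∞) → [0, ∞)`. -/
structure IsAdmissible (d : ℕ) [NeZero d] (φ : ℝ≥0 → ℝ≥0) : Prop where
  /-- `φ` is continuous except at finitely many points of `(0, ∞)`. -/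
  continuous_off_finite : ∃ F : Set ℝ≥0, F.Finite ∧ F ⊆ Ioi 0 ∧ ∀ t ∉ F, ContinuousAt φ t
  map_zero : φ 0 = 0
  /-- One-sided limits `l = φ(t-)`, `r = φ(t+)` exist, and `φ(t) = min {φ(t+), φ(t-)}`. -/
  eq_min_limits : ∀ t : ℝ≥0, 0 < t → ∃ l r : ℝ≥0,
    Tendsto φ (𝓝[<] t) (𝓝 l) ∧ Tendsto φ (𝓝[>] t) (𝓝 r) ∧ φ t = min r l
  quadratic_bound : ∃ a : ℝ≥0, 0 < a ∧ ∀ t ≤ 1, φ t ≤ a * t ^ 2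
  bounded : ∃ b : ℝ≥0, 0 < b ∧ ∀ t, φ t ≤ b
  mono : Monotone φ
  normalized :
    gammaConst d * ∫⁻ t in Ioi (0 : ℝ), (φ t.toNNReal : ℝ≥0∞) / ENNReal.ofReal (t ^ 2) = 1

def admissible (d : ℕ) [NeZero d] : Set (ℝ≥0 → ℝ≥0) := {φ | IsAdmissible d φ}

/-- `K(u, φ, Ω) = inf liminf_{δ → 0+} Λ_δ(v_δ, φ, Ω)`, the infimum over all families
`(v_δ)_{δ ∈ (0,1)}` in `L¹(Ω)` with `v_δ → u` in `L¹(Ω)` as `δ → 0+`. -/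
def K {d : ℕ} (u : EuclideanSpace ℝ (Fin d) → ℝ) (φ : ℝ≥0 → ℝ≥0)
    (Ω : Set (EuclideanSpace ℝ (Fin d))) : ℝ≥0∞ :=
  ⨅ (v : ℝ → EuclideanSpace ℝ (Fin d) → ℝ)
    (_ : ∀ δ ∈ Ioo (0 : ℝ) 1, MemLp (v δ) 1 (volume.restrict Ω))
    (_ : Tendsto (fun δ => eLpNorm (v δ - u) 1 (volume.restrict Ω)) (𝓝[>] 0) (𝓝 0)),
    liminf (fun δ => LamDelta φ Ω δ (v δ)) (𝓝[>] 0)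

/-- The cube `Q = [0, 1]^d`. -/
def cube (d : ℕ) : Set (EuclideanSpace ℝ (Fin d)) := {x | ∀ i, x i ∈ Icc (0 : ℝ) 1}

/-- `U(x) = (x₁ + ⋯ + x_d) / √d`. -/
def U (d : ℕ) (x : EuclideanSpace ℝ (Fin d)) : ℝ := (∑ i, x i) / √(d : ℝ)

/-- `κ(φ) = K(U, φ, Q)`. -/
def kappa (d : ℕ) (φ : ℝ≥0 → ℝ≥0) : ℝ≥0∞ := K (U d) φ (cube d)

/-- The step function `φ̃₁`: `0` on `[0, 1]` and `1` on `(1, ∞)`. -/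
def stepFun (t : ℝ≥0) : ℝ≥0 := if t ≤ 1 then 0 else 1

/-- The normalizing constant `c₁ = 1 / γ_d`, for which `c₁ φ̃₁ ∈ 𝒜`
(see `c1_smul_stepFun_mem_admissible`). -/
def c1 (d : ℕ) [NeZero d] : ℝ≥0 := (gammaConst d)⁻¹.toNNReal

theorem gammaConst_ne_top (d : ℕ) [NeZero d] : gammaConst d ≠ ∞ := by
  refine ((lintegral_mono (g := fun _ => (1 : ℝ≥0∞)) fun σ => ?_).trans_lt ?_).ne
  · have h := norm_inner_le_norm (𝕜 := ℝ) (σ : EuclideanSpace ℝ (Fin d))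
      (EuclideanSpace.single (0 : Fin d) (1 : ℝ))
    have hσ : ‖(σ : EuclideanSpace ℝ (Fin d))‖ = 1 := by simp
    rw [hσ, PiLp.norm_single, norm_one, mul_one] at h
    rw [← ofReal_norm]
    exact ENNReal.ofReal_le_one.2 h
  · rw [lintegral_one]
    exact measure_lt_top _ _

theorem gammaConst_ne_zero (d : ℕ) [NeZero d] : gammaConst d ≠ 0 := by
  have hc : Continuous fun σ : Metric.sphere (0 : EuclideanSpace ℝ (Fin d)) 1 =>
      ‖inner ℝ (σ : EuclideanSpace ℝ (Fin d)) (EuclideanSpace.single (0 : Fin d) (1 : ℝ))‖ₑ := by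
    fun_prop
  intro h
  have h0 := (lintegral_eq_zero_iff hc.measurable).1 h
  have h1 := congrFun ((hc.ae_eq_iff_eq _ continuous_zero).1 h0)
    ⟨EuclideanSpace.single (0 : Fin d) (1 : ℝ), by simp⟩
  simp at h1

theorem c1_smul_stepFun_mem_admissible (d : ℕ) [NeZero d] :
    c1 d • stepFun ∈ admissible d := by
  have hlin : ∫⁻ t in Ioi (0 : ℝ), (((c1 d • stepFun) t.toNNReal : ℝ≥0) : ℝ≥0∞) /
      ENNReal.ofReal (t ^ 2) = c1 d := by
    have h1 : ∫⁻ t in Ioi (0 : ℝ), (((c1 d • stepFun) t.toNNReal : ℝ≥0) : ℝ≥0∞) /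
        ENNReal.ofReal (t ^ 2) =
        ∫⁻ t in Ioi (0 : ℝ), (Ioi (1 : ℝ)).indicator
          (fun t => (c1 d : ℝ≥0∞) * ENNReal.ofReal (t ^ (-2 : ℝ))) t := by
      refine setLIntegral_congr_fun measurableSet_Ioi fun t ht => ?_
      have ht0 : (0 : ℝ) < t := ht
      by_cases h : 1 < t
      · have : ¬ t.toNNReal ≤ 1 := by simpa using h
        simp only [Pi.smul_apply, stepFun, this, if_false, smul_eq_mul, mul_one]
        rw [indicator_of_mem (by exact h), div_eq_mul_inv, ← ENNReal.ofReal_inv_of_pos (by positivity),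
          Real.rpow_neg ht0.le]
        norm_num
      · have h' : t.toNNReal ≤ 1 := by simpa using not_lt.1 h
        rw [indicator_of_notMem (by exact h)]
        simp [stepFun, h']
    rw [h1, lintegral_indicator measurableSet_Ioi, Measure.restrict_restrict measurableSet_Ioi,
      inter_eq_self_of_subset_left (Ioi_subset_Ioi zero_le_one), lintegral_const_mul' _ _ (by simp),
      ← ofReal_integral_eq_lintegral_ofReal (integrableOn_Ioi_rpow_of_lt (by norm_num) one_pos),
      integral_Ioi_rpow_of_lt (by norm_num) one_pos]
    · norm_num
    · exact (ae_restrict_mem measurableSet_Ioi).mono fun t ht =>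
        Real.rpow_nonneg (zero_le_one.trans (le_of_lt ht)) _
  have hlt : ∀ t : ℝ≥0, t < 1 → stepFun =ᶠ[𝓝 t] fun _ => 0 := fun t ht =>
    Filter.mem_of_superset (Iio_mem_nhds ht) fun s hs => if_pos (le_of_lt hs)
  have hgt : ∀ t : ℝ≥0, 1 < t → stepFun =ᶠ[𝓝 t] fun _ => 1 := fun t ht =>
    Filter.mem_of_superset (Ioi_mem_nhds ht) fun s hs => if_neg (not_le.2 hs)
  have hcont : ∀ t : ℝ≥0, t ≠ 1 → ContinuousAt (c1 d • stepFun) t := fun t ht => by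
    refine ContinuousAt.const_smul ?_ (c1 d)
    rcases lt_or_gt_of_ne ht with h | h
    · exact continuousAt_const.congr (hlt t h).symm
    · exact continuousAt_const.congr (hgt t h).symm
  refine ⟨⟨{1}, finite_singleton 1, by simp, fun t ht => hcont t (by simpa using ht)⟩,
    by simp [stepFun], fun t _ => ?_, ⟨1, one_pos, fun t ht => by simp [stepFun, ht]⟩,
    ⟨c1 d + 1, by positivity, fun t => ?_⟩, fun s t hst => ?_, ?_⟩
  · by_cases ht : t = 1
    · subst ht
      refine ⟨0, c1 d, ?_, ?_, by simp [stepFun]⟩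
      · refine tendsto_const_nhds.congr' ?_
        filter_upwards [self_mem_nhdsWithin] with s hs
        have : s ≤ 1 := le_of_lt (mem_Iio.1 hs)
        simp [stepFun, this]
      · refine tendsto_const_nhds.congr' ?_
        filter_upwards [self_mem_nhdsWithin] with s hs
        have : ¬ s ≤ 1 := not_le.2 hs
        simp [stepFun, this]
    · exact ⟨_, _, (hcont t ht).tendsto.mono_left nhdsWithin_le_nhds,
        (hcont t ht).tendsto.mono_left nhdsWithin_le_nhds, (min_self _).symm⟩
  · by_cases h : t ≤ 1 <;> simp [stepFun, h]
  · by_cases h : s ≤ 1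
    · simp [stepFun, h]
    · have h' : ¬ t ≤ 1 := fun ht => h (hst.trans ht)
      simp [stepFun, h, h']
  · rw [hlin, c1, ENNReal.coe_toNNReal (ENNReal.inv_ne_top.2 (gammaConst_ne_zero d)),
      ENNReal.mul_inv_cancel (gammaConst_ne_zero d) (gammaConst_ne_top d)]

end NonlocalTV

end

noncomputable section

namespace NonlocalTV

/-! The comparison is a layer-cake argument followed by Fatou. Write `φ = ∫₀^∞ 1_{φ > r} dr`.
Monotonicity, the rule `φ(t) = min {φ(t+), φ(t-)}` and the quadratic bound make each nonempty level
set `{φ > r}` an open half-line `(s, ∞)` with `s > 0` (`IsAdmissible.lt_iff`). For such an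
indicator, `Λ_δ` is `1/s` times the step energy at scale `δ s` (`LamDelta_indicator_Ioi`), and
rescaling the parameter of a family that converges to `U` leaves it a competitor, so the inner
liminf is at least `K(U, φ̃₁, Q) / s`. Since `1/s = ∫_s^∞ t⁻² dt`, integrating in `r` rebuilds `∫ φ
t⁻² dt = c₁`, whence `K_stepFun_le_liminf`.

The infimum is then positive as soon as `κ(φ̃₁) > 0`. The heart is one-dimensional
(`le_energy_add_lintegral`): if `g` is `L¹`-close on `(0,1]` to an affine function of slope `β`,
then `δ ∬ 1_{|g(s)-g(t)|>δ} / |s-t|²` is at least a multiple of `β`. Take about `β/(4δ)` consecutive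
bands `[T+iδ, T+(i+1)δ)` of values. For most `i`, a continuity and halving argument finds a window
in which the points below, inside and above the band each fill a quarter of the length
(`exists_window`), unless the energy is infinite. The pairs (below, above) in a window of length `ρ`
jump by more than `δ` and lie at distance at most `ρ`, so they carry energy at least `1/16`. Windows
of different bands may overlap, but their parts inside the bands are disjoint, which bounds the
overcounting of each pair by a fixed factor (`sum_inv_sq_le`).

In dimension `d = n + 1`, this estimate is averaged over the segments `s ↦ (s, z + s θ)` with `z, θ
∈ [0,1/2]ⁿ`. They stay in the cube and `U` has slope at least `1/√d` along them; the Jacobian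
`|s-t|⁻ⁿ` turns the kernel `|s-t|⁻²` into `|s-t|^{-(d+1)}` (`lintegral_energy_line_le`). -/

/-- The indicator of the superlevel set `{t | r < φ t}`. -/
def levelFun (φ : ℝ≥0 → ℝ≥0) (r : ℝ) (t : ℝ≥0) : ℝ≥0 := if r < φ t then 1 else 0

theorem coe_eq_lintegral_levelFun (φ : ℝ≥0 → ℝ≥0) (t : ℝ≥0) :
    (φ t : ℝ≥0∞) = ∫⁻ r in Ioi (0 : ℝ), (levelFun φ r t : ℝ≥0∞) := by
  have h : ∀ r : ℝ, (levelFun φ r t : ℝ≥0∞) = (Iio (φ t : ℝ)).indicator 1 r := fun r => by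
    by_cases hr : r < φ t <;> simp [levelFun, hr]
  simp_rw [h]
  rw [lintegral_indicator_one measurableSet_Iio, Measure.restrict_apply measurableSet_Iio,
    inter_comm, Ioi_inter_Iio, Real.volume_Ioo]
  simp

theorem measurable_levelFun {α : Type*} [MeasurableSpace α] {φ : ℝ≥0 → ℝ≥0} (hφ : Measurable φ)
    {f : α → ℝ} {g : α → ℝ≥0} (hf : Measurable f) (hg : Measurable g) :
    Measurable fun a => (levelFun φ (f a) (g a) : ℝ≥0∞) := by
  refine Measurable.coe_nnreal_ennreal (Measurable.ite ?_ measurable_const measurable_const)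
  exact measurableSet_lt hf ((hφ.comp hg).coe_nnreal_real)

/-! ### Layer-cake decomposition and comparison with the step function. -/

section LayerCake

variable {d : ℕ}

theorem measurable_Lam_integrand {φ : ℝ≥0 → ℝ≥0} (hφ : Measurable φ)
    {u : EuclideanSpace ℝ (Fin d) → ℝ} (hu : Measurable u) :
    Measurable fun q : (ℝ × EuclideanSpace ℝ (Fin d)) × EuclideanSpace ℝ (Fin d) =>
      (levelFun φ q.1.1 ‖u q.1.2 - u q.2‖₊ : ℝ≥0∞) / edist q.1.2 q.2 ^ (d + 1) := by
  refine (measurable_levelFun hφ (by fun_prop) (by fun_prop)).div ?_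
  exact (measurable_fst.snd.edist measurable_snd).pow_const _

theorem Lam_eq_lintegral_levelFun {φ : ℝ≥0 → ℝ≥0} (hφ : Measurable φ)
    {u : EuclideanSpace ℝ (Fin d) → ℝ} (hu : Measurable u) (Ω : Set (EuclideanSpace ℝ (Fin d))) :
    Lam φ Ω u = ∫⁻ r in Ioi (0 : ℝ), Lam (levelFun φ r) Ω u := by
  have hm := measurable_Lam_integrand hφ hu
  unfold Lam
  have h : ∀ x y : EuclideanSpace ℝ (Fin d),
      (φ ‖u x - u y‖₊ : ℝ≥0∞) / edist x y ^ (d + 1) = ∫⁻ r in Ioi (0 : ℝ),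
        (levelFun φ r ‖u x - u y‖₊ : ℝ≥0∞) / edist x y ^ (d + 1) := fun x y => by
    simp_rw [div_eq_mul_inv]
    rw [coe_eq_lintegral_levelFun φ, lintegral_mul_const]
    exact measurable_levelFun hφ measurable_id measurable_const
  simp_rw [h]
  have h2 : ∀ x : EuclideanSpace ℝ (Fin d), ∫⁻ y in Ω, ∫⁻ r in Ioi (0 : ℝ),
        (levelFun φ r ‖u x - u y‖₊ : ℝ≥0∞) / edist x y ^ (d + 1) =
      ∫⁻ r in Ioi (0 : ℝ), ∫⁻ y in Ω,
        (levelFun φ r ‖u x - u y‖₊ : ℝ≥0∞) / edist x y ^ (d + 1) := fun x => by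
    rw [lintegral_lintegral_swap]
    exact (hm.comp (f := fun q : EuclideanSpace ℝ (Fin d) × ℝ => ((q.2, x), q.1))
      (by fun_prop)).aemeasurable
  simp_rw [h2]
  rw [lintegral_lintegral_swap]
  exact ((hm.lintegral_prod_right' (ν := volume.restrict Ω)).comp measurable_swap).aemeasurable

theorem measurable_Lam_levelFun {φ : ℝ≥0 → ℝ≥0} (hφ : Measurable φ)
    {u : EuclideanSpace ℝ (Fin d) → ℝ} (hu : Measurable u) (Ω : Set (EuclideanSpace ℝ (Fin d))) :
    Measurable fun r => Lam (levelFun φ r) Ω u :=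
  (measurable_Lam_integrand hφ hu).lintegral_prod_right'.lintegral_prod_right'

theorem LamDelta_eq_lintegral_levelFun {φ : ℝ≥0 → ℝ≥0} (hφ : Measurable φ)
    {u : EuclideanSpace ℝ (Fin d) → ℝ} (hu : Measurable u) (Ω : Set (EuclideanSpace ℝ (Fin d)))
    (δ : ℝ) :
    LamDelta φ Ω δ u = ∫⁻ r in Ioi (0 : ℝ), LamDelta (levelFun φ r) Ω δ u := by
  unfold LamDelta
  rw [Lam_eq_lintegral_levelFun hφ (hu.div_const δ),
    lintegral_const_mul _ (measurable_Lam_levelFun hφ (hu.div_const δ) Ω)]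

theorem LamDelta_congr_ae {φ : ℝ≥0 → ℝ≥0} {Ω : Set (EuclideanSpace ℝ (Fin d))} {δ : ℝ}
    {u v : EuclideanSpace ℝ (Fin d) → ℝ} (h : u =ᵐ[volume.restrict Ω] v) :
    LamDelta φ Ω δ u = LamDelta φ Ω δ v := by
  unfold LamDelta Lam
  congr 1
  refine lintegral_congr_ae (h.mono fun x hx => lintegral_congr_ae (h.mono fun y hy => ?_))
  simp only [hx, hy]

theorem LamDelta_smul (c : ℝ≥0) (φ : ℝ≥0 → ℝ≥0) (Ω : Set (EuclideanSpace ℝ (Fin d))) (δ : ℝ)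
    (u : EuclideanSpace ℝ (Fin d) → ℝ) :
    LamDelta (c • φ) Ω δ u = c * LamDelta φ Ω δ u := by
  unfold LamDelta Lam
  simp only [Pi.smul_apply, smul_eq_mul, ENNReal.coe_mul, mul_div_assoc]
  simp_rw [lintegral_const_mul' (c : ℝ≥0∞) _ ENNReal.coe_ne_top]
  ring

/-- Rescaling `δ` turns the indicator of `(s, ∞)` into the step function. -/
theorem LamDelta_indicator_Ioi {s : ℝ≥0} (hs : 0 < s) {δ : ℝ} (hδ : 0 < δ)
    (Ω : Set (EuclideanSpace ℝ (Fin d))) (u : EuclideanSpace ℝ (Fin d) → ℝ) :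
    LamDelta (fun t => if s < t then 1 else 0) Ω δ u =
      ENNReal.ofReal (1 / s) * LamDelta stepFun Ω (δ * s) u := by
  have hs' : (0 : ℝ) < s := hs
  unfold LamDelta
  rw [← mul_assoc, ← ENNReal.ofReal_mul (by positivity)]
  congr 1
  · congr 1
    field_simp
  · unfold Lam
    refine lintegral_congr fun x => lintegral_congr fun y => ?_
    congr 2
    have h1 : u x / (δ * s) - u y / (δ * s) = (u x / δ - u y / δ) / s := by field_simp
    have h2 : (s : ℝ≥0) < ‖u x / δ - u y / δ‖₊ ↔ ¬ ‖u x / (δ * s) - u y / (δ * s)‖₊ ≤ 1 := by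
      rw [h1, not_le, ← NNReal.coe_lt_coe, ← NNReal.coe_lt_coe, coe_nnnorm, coe_nnnorm, norm_div,
        Real.norm_of_nonneg hs'.le, NNReal.coe_one, one_lt_div hs']
    by_cases h : s < ‖u x / δ - u y / δ‖₊
    · simp only [stepFun, if_pos h, if_neg (h2.1 h)]
    · simp only [stepFun, if_neg h, if_pos (not_not.1 (mt h2.2 h))]

/-- The reparametrised family `δ ↦ v (δ / s)` is again a competitor for `K`. -/
theorem K_le_liminf_mul {φ : ℝ≥0 → ℝ≥0} {Ω : Set (EuclideanSpace ℝ (Fin d))}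
    {u : EuclideanSpace ℝ (Fin d) → ℝ} {v : ℝ → EuclideanSpace ℝ (Fin d) → ℝ}
    (hv : ∀ δ ∈ Ioo (0 : ℝ) 1, MemLp (v δ) 1 (volume.restrict Ω))
    (hvu : Tendsto (fun δ => eLpNorm (v δ - u) 1 (volume.restrict Ω)) (𝓝[>] 0) (𝓝 0))
    {s : ℝ} (hs : 0 < s) :
    K u φ Ω ≤ liminf (fun δ => LamDelta φ Ω (δ * s) (v δ)) (𝓝[>] 0) := by
  have hmap : ∀ c : ℝ, 0 < c → Tendsto (fun δ => δ * c) (𝓝[>] (0 : ℝ)) (𝓝[>] 0) := fun c hc => by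
    refine tendsto_nhdsWithin_iff.2 ⟨?_, ?_⟩
    · have : Tendsto (fun δ => δ * c) (𝓝 (0 : ℝ)) (𝓝 (0 * c)) :=
        (continuous_mul_const c).tendsto 0
      rw [zero_mul] at this
      exact this.mono_left nhdsWithin_le_nhds
    · filter_upwards [self_mem_nhdsWithin] with δ hδ using mul_pos hδ hc
  have hlt : ∀ c : ℝ, 0 < c → ∀ᶠ δ in 𝓝[>] (0 : ℝ), δ < c := fun c hc =>
    nhdsWithin_le_nhds (Iio_mem_nhds hc)
  -- Integrability of `v` is known only for parameters in `(0, 1)`; the default value `0` is never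
  -- seen near `δ = 0`.
  let w : ℝ → EuclideanSpace ℝ (Fin d) → ℝ := fun δ => if δ / s < 1 then v (δ / s) else 0
  have hw : ∀ δ ∈ Ioo (0 : ℝ) 1, MemLp (w δ) 1 (volume.restrict Ω) := fun δ hδ => by
    by_cases h : δ / s < 1
    · simpa only [w, if_pos h] using hv _ ⟨div_pos hδ.1 hs, h⟩
    · simp only [w, if_neg h]
      exact MemLp.zero
  have hwu : Tendsto (fun δ => eLpNorm (w δ - u) 1 (volume.restrict Ω)) (𝓝[>] 0) (𝓝 0) := by
    refine (hvu.comp (hmap s⁻¹ (inv_pos.2 hs))).congr' ?_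
    filter_upwards [hlt s hs] with δ hδ
    simp only [w, Function.comp, ← div_eq_mul_inv, if_pos ((div_lt_one hs).2 hδ)]
  refine (iInf₂_le_of_le w hw (iInf_le _ hwu)).trans ?_
  have h1 : (fun δ => LamDelta φ Ω (δ * s) (v δ)) =ᶠ[𝓝[>] 0]
      (fun δ => LamDelta φ Ω δ (w δ)) ∘ fun δ => δ * s := by
    filter_upwards [hlt 1 one_pos] with δ hδ
    simp only [w, Function.comp, mul_div_cancel_right₀ _ hs.ne', if_pos hδ]
  rw [liminf_congr h1, liminf_comp]
  exact liminf_le_liminf_of_le (hmap s hs)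

/-- The weight `t⁻²` of the normalization gives a half-line exactly the factor `1/s` that appears in
`LamDelta_indicator_Ioi`; this match is what makes the step function extremal. -/
theorem lintegral_indicator_Ioi_div_sq {s : ℝ≥0} (hs : 0 < s) :
    ∫⁻ t in Ioi (0 : ℝ), ((if s < t.toNNReal then 1 else 0 : ℝ≥0) : ℝ≥0∞) /
      ENNReal.ofReal (t ^ 2) = ENNReal.ofReal (1 / s) := by
  have hs' : (0 : ℝ) < s := hs
  have h1 : ∫⁻ t in Ioi (0 : ℝ), ((if s < t.toNNReal then 1 else 0 : ℝ≥0) : ℝ≥0∞) /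
        ENNReal.ofReal (t ^ 2) =
      ∫⁻ t in Ioi (0 : ℝ), (Ioi (s : ℝ)).indicator
        (fun t => ENNReal.ofReal (t ^ (-2 : ℝ))) t := by
    refine setLIntegral_congr_fun measurableSet_Ioi fun t ht => ?_
    have ht0 : (0 : ℝ) < t := ht
    by_cases h : (s : ℝ) < t
    · have h' : s < t.toNNReal := Real.lt_toNNReal_iff_coe_lt.2 h
      simp only [h', if_true]
      rw [indicator_of_mem (by exact h), div_eq_mul_inv,
        ← ENNReal.ofReal_inv_of_pos (by positivity), Real.rpow_neg ht0.le]
      norm_num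
    · have h' : ¬ s < t.toNNReal := fun h' => h (Real.lt_toNNReal_iff_coe_lt.1 h')
      rw [indicator_of_notMem (by exact h)]
      simp [h']
  rw [h1, lintegral_indicator measurableSet_Ioi, Measure.restrict_restrict measurableSet_Ioi,
    inter_eq_self_of_subset_left (Ioi_subset_Ioi hs'.le),
    ← ofReal_integral_eq_lintegral_ofReal (integrableOn_Ioi_rpow_of_lt (by norm_num) hs'),
    integral_Ioi_rpow_of_lt (by norm_num) hs']
  · norm_num [Real.rpow_neg_one]
  · exact (ae_restrict_mem measurableSet_Ioi).mono fun t ht =>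
      Real.rpow_nonneg (hs'.le.trans (le_of_lt ht)) _

/-- A family may be replaced by a family of measurable representatives. -/
theorem le_K_of_measurable {φ : ℝ≥0 → ℝ≥0} {Ω : Set (EuclideanSpace ℝ (Fin d))}
    {u : EuclideanSpace ℝ (Fin d) → ℝ} {C : ℝ≥0∞}
    (h : ∀ v : ℝ → EuclideanSpace ℝ (Fin d) → ℝ,
      (∀ δ ∈ Ioo (0 : ℝ) 1, MemLp (v δ) 1 (volume.restrict Ω)) →
      Tendsto (fun δ => eLpNorm (v δ - u) 1 (volume.restrict Ω)) (𝓝[>] 0) (𝓝 0) →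
      (∀ δ, Measurable (v δ)) → C ≤ liminf (fun δ => LamDelta φ Ω δ (v δ)) (𝓝[>] 0)) :
    C ≤ K u φ Ω := by
  refine le_iInf₂ fun v hv => le_iInf fun hvu => ?_
  classical
  let w : ℝ → EuclideanSpace ℝ (Fin d) → ℝ := fun δ =>
    if h : δ ∈ Ioo (0 : ℝ) 1 then (hv δ h).1.aemeasurable.mk (v δ) else 0
  have hwm : ∀ δ, Measurable (w δ) := fun δ => by
    by_cases h : δ ∈ Ioo (0 : ℝ) 1
    · simp only [w, dif_pos h]
      exact (hv δ h).1.aemeasurable.measurable_mk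
    · simp only [w, dif_neg h]
      exact measurable_const
  have hwv : ∀ δ ∈ Ioo (0 : ℝ) 1, v δ =ᵐ[volume.restrict Ω] w δ := fun δ h => by
    simp only [w, dif_pos h]
    exact (hv δ h).1.aemeasurable.ae_eq_mk
  have hev : ∀ᶠ δ in 𝓝[>] (0 : ℝ), δ ∈ Ioo (0 : ℝ) 1 := Ioo_mem_nhdsGT one_pos
  have h1 := h w (fun δ hδ => (memLp_congr_ae (hwv δ hδ)).1 (hv δ hδ)) (hvu.congr' ?_) hwm
  · refine h1.trans_eq (liminf_congr ?_)
    filter_upwards [hev] with δ hδ using LamDelta_congr_ae (hwv δ hδ).symm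
  · filter_upwards [hev] with δ hδ
    exact eLpNorm_congr_ae ((hwv δ hδ).sub (ae_eq_refl u))

theorem K_smul (c : ℝ≥0) (hc : c ≠ 0) (φ : ℝ≥0 → ℝ≥0) (Ω : Set (EuclideanSpace ℝ (Fin d)))
    (u : EuclideanSpace ℝ (Fin d) → ℝ) : K u (c • φ) Ω = c * K u φ Ω := by
  unfold K
  simp_rw [LamDelta_smul, ENNReal.liminf_const_mul_of_ne_top ENNReal.coe_ne_top,
    ENNReal.mul_iInf_of_ne (ENNReal.coe_ne_zero.2 hc) ENNReal.coe_ne_top]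

variable [NeZero d]

/-- The superlevel sets of an admissible function are empty or open half-lines. -/
theorem IsAdmissible.lt_iff {φ : ℝ≥0 → ℝ≥0} (hφ : IsAdmissible d φ) {r : ℝ} (hr : 0 < r)
    (hne : ∃ t, r < φ t) : ∃ s : ℝ≥0, 0 < s ∧ ∀ t, r < φ t ↔ s < t := by
  have key : ∀ t, r < φ t ↔ sInf {t | r < φ t} < t := fun t => by
    constructor
    · intro ht
      have ht0 : 0 < t := by
        rcases eq_or_ne t 0 with rfl | h
        · rw [hφ.map_zero] at ht
          exact absurd hr (not_lt.2 (by simpa using ht.le))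
        · exact pos_iff_ne_zero.2 h
      -- The minimum rule gives `φ(t) ≤ φ(t-)`, so the level is already exceeded slightly to the
      -- left of `t`: the half-line is open.
      obtain ⟨l, _, hl, -, hlr⟩ := hφ.eq_min_limits t ht0
      have hrl : r < l := ht.trans_le (by rw [hlr]; exact_mod_cast min_le_right _ _)
      have hl' : Tendsto (fun t => (φ t : ℝ)) (𝓝[<] t) (𝓝 l) := NNReal.tendsto_coe.2 hl
      have : (𝓝[<] t).NeBot := nhdsLT_neBot_of_exists_lt ⟨0, ht0⟩
      obtain ⟨t', h1, h2⟩ := ((hl'.eventually (lt_mem_nhds hrl)).and self_mem_nhdsWithin).exists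
      exact (csInf_le (OrderBot.bddBelow _) (show t' ∈ {t | r < φ t} from h1)).trans_lt h2
    · intro ht
      obtain ⟨t', h1, h2⟩ := exists_lt_of_csInf_lt hne ht
      exact lt_of_lt_of_le h1 (NNReal.coe_le_coe.2 (hφ.mono h2.le))
  refine ⟨_, pos_iff_ne_zero.2 fun h0 => ?_, key⟩
  -- If the half-line began at `0`, then `φ > r > 0` would hold arbitrarily near `0`, against `φ(t)
  -- ≤ a t²`.
  obtain ⟨a, ha, hq⟩ := hφ.quadratic_bound
  have hlim : Tendsto (fun t : ℝ≥0 => ((a * t ^ 2 : ℝ≥0) : ℝ)) (𝓝[>] 0) (𝓝 0) := by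
    have : Continuous fun t : ℝ≥0 => ((a * t ^ 2 : ℝ≥0) : ℝ) := by fun_prop
    simpa using (this.tendsto 0).mono_left (nhdsWithin_le_nhds (s := Ioi 0))
  obtain ⟨t, ⟨h1, h2⟩, h3⟩ := ((hlim.eventually (gt_mem_nhds hr)).and
    (nhdsWithin_le_nhds (Iio_mem_nhds one_pos)) |>.and self_mem_nhdsWithin).exists
  have := (key t).2 (h0 ▸ h3)
  exact absurd (this.trans_le (NNReal.coe_le_coe.2 (hq t (le_of_lt h2)))) (not_lt.2 h1.le)

theorem coe_c1_ne_zero (d : ℕ) [NeZero d] : (c1 d : ℝ≥0∞) ≠ 0 := by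
  rw [c1, ENNReal.coe_toNNReal (ENNReal.inv_ne_top.2 (gammaConst_ne_zero d))]
  exact ENNReal.inv_ne_zero.2 (gammaConst_ne_top d)

theorem IsAdmissible.lintegral_div_sq {φ : ℝ≥0 → ℝ≥0} (hφ : IsAdmissible d φ) :
    ∫⁻ t in Ioi (0 : ℝ), (φ t.toNNReal : ℝ≥0∞) / ENNReal.ofReal (t ^ 2) = c1 d := by
  rw [c1, ENNReal.coe_toNNReal (ENNReal.inv_ne_top.2 (gammaConst_ne_zero d))]
  exact (ENNReal.eq_inv_of_mul_eq_one_left (by rw [mul_comm]; exact hφ.normalized))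

theorem IsAdmissible.lintegral_levelFun_div_sq {φ : ℝ≥0 → ℝ≥0} (hφ : IsAdmissible d φ) :
    ∫⁻ r in Ioi (0 : ℝ), ∫⁻ t in Ioi (0 : ℝ),
      (levelFun φ r t.toNNReal : ℝ≥0∞) / ENNReal.ofReal (t ^ 2) = c1 d := by
  have hm := hφ.mono.measurable
  rw [← hφ.lintegral_div_sq, lintegral_lintegral_swap]
  · refine lintegral_congr fun t => ?_
    simp_rw [div_eq_mul_inv]
    rw [coe_eq_lintegral_levelFun φ, lintegral_mul_const]
    exact measurable_levelFun hm measurable_id measurable_const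
  · exact ((measurable_levelFun hm measurable_fst measurable_snd.real_toNNReal).div
      (by fun_prop : Measurable fun q : ℝ × ℝ => ENNReal.ofReal (q.2 ^ 2))).aemeasurable

/-- Fatou's lemma in the level `r` reduces the bound to a single level set, where scaling applies;
measurability of the family is what Tonelli and Fatou require. -/
theorem K_stepFun_le_liminf {φ : ℝ≥0 → ℝ≥0} (hφ : IsAdmissible d φ)
    {Ω : Set (EuclideanSpace ℝ (Fin d))}
    {u : EuclideanSpace ℝ (Fin d) → ℝ} {v : ℝ → EuclideanSpace ℝ (Fin d) → ℝ}
    (hv : ∀ δ ∈ Ioo (0 : ℝ) 1, MemLp (v δ) 1 (volume.restrict Ω))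
    (hvu : Tendsto (fun δ => eLpNorm (v δ - u) 1 (volume.restrict Ω)) (𝓝[>] 0) (𝓝 0))
    (hmeas : ∀ δ, Measurable (v δ)) :
    c1 d * K u stepFun Ω ≤ liminf (fun δ => LamDelta φ Ω δ (v δ)) (𝓝[>] 0) := by
  have hm := hφ.mono.measurable
  simp_rw [fun δ => LamDelta_eq_lintegral_levelFun hm (hmeas δ) Ω δ]
  refine le_trans ?_ (lintegral_liminf_le fun δ =>
    (measurable_Lam_levelFun hm ((hmeas δ).div_const δ) Ω).const_mul _)
  rw [← hφ.lintegral_levelFun_div_sq, ← lintegral_mul_const]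
  swap
  · exact ((measurable_levelFun hm measurable_fst measurable_snd.real_toNNReal).div
      (by fun_prop : Measurable fun q : ℝ × ℝ => ENNReal.ofReal (q.2 ^ 2))).lintegral_prod_right'
  refine setLIntegral_mono' measurableSet_Ioi fun r hr => ?_
  by_cases hne : ∃ t, r < φ t
  · obtain ⟨s, hs, hlt⟩ := hφ.lt_iff hr hne
    have hlev : levelFun φ r = fun t => if s < t then 1 else 0 := by
      ext t; simp only [levelFun, hlt]
    simp only [hlev]
    rw [lintegral_indicator_Ioi_div_sq hs]
    have h1 : (fun δ => LamDelta (fun t => if s < t then 1 else 0) Ω δ (v δ)) =ᶠ[𝓝[>] 0]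
        fun δ => ENNReal.ofReal (1 / s) * LamDelta stepFun Ω (δ * s) (v δ) := by
      filter_upwards [self_mem_nhdsWithin] with δ hδ using LamDelta_indicator_Ioi hs hδ Ω _
    rw [liminf_congr h1, ENNReal.liminf_const_mul_of_ne_top ENNReal.ofReal_ne_top]
    exact mul_le_mul_right (K_le_liminf_mul hv hvu hs) _
  · have hlev : ∀ t, levelFun φ r t = 0 := fun t => if_neg fun h => hne ⟨t, h⟩
    simp [hlev]

theorem kappa_stepFun_le {φ : ℝ≥0 → ℝ≥0} (hφ : IsAdmissible d φ) :
    kappa d (c1 d • stepFun) ≤ kappa d φ := by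
  unfold kappa
  rw [K_smul _ (ENNReal.coe_ne_zero.1 (coe_c1_ne_zero d))]
  exact le_K_of_measurable fun v hv hvu hm => K_stepFun_le_liminf hφ hv hvu hm

end LayerCake

/-! ### Balanced windows -/

/-- The increments of `F` over the two halves of the chord add up to zero, so the increment over a
sliding half-length window vanishes somewhere in between. -/
theorem exists_half_chord {F : ℝ → ℝ} (hF : Continuous F) {x ρ : ℝ} (hρ : 0 ≤ ρ)
    (h : F (x + 2 * ρ) = F x) : ∃ y ∈ Icc x (x + ρ), F (y + ρ) = F y := by
  have hG : Continuous fun y => F (y + ρ) - F y := by fun_prop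
  have h1 := intermediate_value_uIcc (a := x) (b := x + ρ) hG.continuousOn
  have h0 : (0 : ℝ) ∈ uIcc (F (x + ρ) - F x) (F (x + ρ + ρ) - F (x + ρ)) := by
    rw [show x + ρ + ρ = x + 2 * ρ by ring, h, mem_uIcc]
    rcases le_total (F (x + ρ)) (F x) with h | h
    · left; constructor <;> linarith
    · right; constructor <;> linarith
  obtain ⟨y, hy, hy0⟩ := h1 h0
  rw [uIcc_of_le (by linarith)] at hy
  exact ⟨y, hy, by simpa [sub_eq_zero] using hy0⟩

/-- The signed excess of `A` over `D` in `(0, x]`. -/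
def excess (A D : Set ℝ) (x : ℝ) : ℝ := ∫ t in (0 : ℝ)..x, (A.indicator 1 t - D.indicator 1 t)

theorem intervalIntegrable_indicator_one {A : Set ℝ} (hA : MeasurableSet A) (a b : ℝ) :
    IntervalIntegrable (A.indicator (1 : ℝ → ℝ)) volume a b := by
  rw [intervalIntegrable_iff]
  exact (integrableOn_const (by simp) (C := (1 : ℝ))).indicator hA

theorem continuous_excess {A D : Set ℝ} (hA : MeasurableSet A) (hD : MeasurableSet D) :
    Continuous (excess A D) :=
  intervalIntegral.continuous_primitive (fun a b =>
    (intervalIntegrable_indicator_one hA a b).sub (intervalIntegrable_indicator_one hD a b)) 0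

theorem excess_add_sub {A D : Set ℝ} (hA : MeasurableSet A) (hD : MeasurableSet D) (x : ℝ) {ρ : ℝ}
    (hρ : 0 ≤ ρ) : excess A D (x + ρ) - excess A D x =
      volume.real (A ∩ Ioc x (x + ρ)) - volume.real (D ∩ Ioc x (x + ρ)) := by
  have hi := intervalIntegrable_indicator_one (A := A) hA
  have hj := intervalIntegrable_indicator_one (A := D) hD
  unfold excess
  rw [intervalIntegral.integral_interval_sub_left ((hi _ _).sub (hj _ _)) ((hi _ _).sub (hj _ _)),
    intervalIntegral.integral_sub (hi _ _) (hj _ _),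
    intervalIntegral.integral_of_le (by linarith), intervalIntegral.integral_of_le (by linarith),
    integral_indicator_one hA, integral_indicator_one hD]
  simp [measureReal_restrict_apply, hA, hD]

theorem measureReal_add_add {A D : Set ℝ} (hA : MeasurableSet A) (hD : MeasurableSet D)
    (hAD : Disjoint A D) (x : ℝ) {ρ : ℝ} (hρ : 0 ≤ ρ) :
    volume.real (A ∩ Ioc x (x + ρ)) + volume.real (D ∩ Ioc x (x + ρ)) +
      volume.real ((A ∪ D)ᶜ ∩ Ioc x (x + ρ)) = ρ := by
  have h1 := measureReal_add_measureReal_compl (μ := volume.restrict (Ioc x (x + ρ)))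
    (hA.union hD)
  rw [measureReal_union hAD hD] at h1
  simp only [measureReal_restrict_apply, hA, hD, (hA.union hD).compl, MeasurableSet.univ,
    univ_inter, Real.volume_real_Ioc] at h1
  rw [h1, add_sub_cancel_left, max_eq_left hρ]

/-- Either some window meets `A`, `D` and the gap between them in at least a quarter of its length,
or windows of all dyadic lengths meet `A` and `D` in at least a quarter of their length. -/
theorem exists_window {A D : Set ℝ} (hA : MeasurableSet A) (hD : MeasurableSet D)
    (hAD : Disjoint A D)
    (h0 : volume.real (D ∩ Ioc 0 (1 / 4)) ≤ volume.real (A ∩ Ioc 0 (1 / 4)))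
    (h1 : volume.real (A ∩ Ioc (3 / 4) 1) ≤ volume.real (D ∩ Ioc (3 / 4) 1))
    (hB : volume.real ((A ∪ D)ᶜ ∩ Ioc 0 1) < 1 / 16) :
    (∃ x ρ : ℝ, 0 < ρ ∧ Ioc x (x + ρ) ⊆ Ioc 0 1 ∧ ρ / 4 ≤ volume.real (A ∩ Ioc x (x + ρ)) ∧
      ρ / 4 ≤ volume.real (D ∩ Ioc x (x + ρ)) ∧
      ρ / 4 ≤ volume.real ((A ∪ D)ᶜ ∩ Ioc x (x + ρ))) ∨
    ∀ n : ℕ, ∃ x : ℝ, Ioc x (x + 1 / 4 * (1 / 2) ^ n) ⊆ Ioc 0 1 ∧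
      1 / 4 * (1 / 2) ^ n / 4 ≤ volume.real (A ∩ Ioc x (x + 1 / 4 * (1 / 2) ^ n)) ∧
      1 / 4 * (1 / 2) ^ n / 4 ≤ volume.real (D ∩ Ioc x (x + 1 / 4 * (1 / 2) ^ n)) := by
  by_cases hex : ∃ x ρ : ℝ, 0 < ρ ∧ Ioc x (x + ρ) ⊆ Ioc 0 1 ∧
      ρ / 4 ≤ volume.real (A ∩ Ioc x (x + ρ)) ∧
      ρ / 4 ≤ volume.real (D ∩ Ioc x (x + ρ)) ∧
      ρ / 4 ≤ volume.real ((A ∪ D)ᶜ ∩ Ioc x (x + ρ))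
  · exact Or.inl hex
  right
  have hF := continuous_excess hA hD
  have main : ∀ n : ℕ, ∃ x : ℝ, Ioc x (x + 1 / 4 * (1 / 2) ^ n) ⊆ Ioc 0 1 ∧
      excess A D (x + 1 / 4 * (1 / 2) ^ n) = excess A D x ∧
      volume.real ((A ∪ D)ᶜ ∩ Ioc x (x + 1 / 4 * (1 / 2) ^ n)) < 1 / 4 * (1 / 2) ^ n / 4 := by
    intro n
    induction n with
    | zero =>
      have e0 := excess_add_sub hA hD 0 (ρ := 1 / 4) (by norm_num)
      have e1 := excess_add_sub hA hD (3 / 4) (ρ := 1 / 4) (by norm_num)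
      norm_num at e0 e1 h0 h1
      -- Slide a window of length `1/4` from the left end, where `A` prevails, to the right end,
      -- where `D` does: some position is balanced. The gap bound `1/16` is a quarter of this
      -- length.
      have hG : Continuous fun y => excess A D (y + 1 / 4) - excess A D y := by fun_prop
      obtain ⟨y, hy, hy0⟩ := intermediate_value_Icc' (a := 0) (b := 3 / 4) (by norm_num)
        hG.continuousOn (show (0 : ℝ) ∈ _ by norm_num; constructor <;> linarith)
      have hsub : Ioc y (y + 1 / 4) ⊆ Ioc 0 1 :=
        Ioc_subset_Ioc hy.1 (by linarith [hy.2])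
      refine ⟨y, by simpa using hsub, by simpa [sub_eq_zero] using hy0, ?_⟩
      refine lt_of_le_of_lt (measureReal_mono (inter_subset_inter_right _ (t := Ioc 0 1)
        (by simpa using hsub)) (measure_inter_lt_top_of_right_ne_top (by simp)).ne) ?_
      norm_num at hB ⊢
      exact hB
    | succ n ih =>
      obtain ⟨x, hsub, hbal, hlt⟩ := ih
      have hρ : (0 : ℝ) < 1 / 4 * (1 / 2) ^ (n + 1) := by positivity
      have h2 : (1 / 4 * (1 / 2) ^ n : ℝ) = 2 * (1 / 4 * (1 / 2) ^ (n + 1)) := by ring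
      rw [h2] at hsub hbal hlt
      set ρ : ℝ := 1 / 4 * (1 / 2) ^ (n + 1)
      obtain ⟨y, hy, hyb⟩ := exists_half_chord hF hρ.le hbal
      have hsub' : Ioc y (y + ρ) ⊆ Ioc x (x + 2 * ρ) := Ioc_subset_Ioc hy.1 (by linarith [hy.2])
      have e := excess_add_sub hA hD y hρ.le
      have tot := measureReal_add_add hA hD hAD y hρ.le
      have hle : volume.real ((A ∪ D)ᶜ ∩ Ioc y (y + ρ)) ≤
          volume.real ((A ∪ D)ᶜ ∩ Ioc x (x + 2 * ρ)) :=
        measureReal_mono (inter_subset_inter_right _ hsub')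
          (measure_inter_lt_top_of_right_ne_top measure_Ioc_lt_top.ne).ne
      refine ⟨y, hsub'.trans hsub, hyb, ?_⟩
      -- The gap fills less than `ρ/2` even in the parent window of length `2ρ`, so balance leaves
      -- more than `ρ/4` to each of `A` and `D`. A gap of at least `ρ/4` would then give the
      -- excluded first alternative.
      by_contra hcon
      exact hex ⟨y, ρ, hρ, hsub'.trans hsub, by linarith, by linarith, not_lt.1 hcon⟩
  intro n
  obtain ⟨x, hsub, hbal, hlt⟩ := main n
  have hρ : (0 : ℝ) < 1 / 4 * (1 / 2) ^ n := by positivity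
  have e := excess_add_sub hA hD x hρ.le
  have tot := measureReal_add_add hA hD hAD x hρ.le
  exact ⟨x, hsub, by linarith, by linarith⟩

/-! ### The packing estimate -/

theorem lintegral_inv_one_add_sq_comp {h : ℝ} (hh : 0 < h) (s : ℝ) :
    ∫⁻ r, ENNReal.ofReal ((1 + ((r - s) / h) ^ 2)⁻¹) = ENNReal.ofReal (h * Real.pi) := by
  have hi : Integrable fun r : ℝ => (1 + ((r - s) / h) ^ 2)⁻¹ :=
    (integrable_inv_one_add_sq.comp_div hh.ne').comp_sub_right s
  rw [← ofReal_integral_eq_lintegral_ofReal hi (ae_of_all _ fun r => by positivity),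
    integral_sub_right_eq_self (fun r : ℝ => (1 + (r / h) ^ 2)⁻¹) s,
    Measure.integral_comp_div (fun r : ℝ => (1 + r ^ 2)⁻¹) h, integral_univ_inv_one_add_sq,
    abs_of_pos hh, smul_eq_mul]

/-- Put `h = |s - t|`. Every interval contains both points, so `h ≤ ρ i`, and each `r ∈ E i` has `|r
- s| ≤ ρ i`. Hence `1/ρ i²` is at most the integral over `E i` of `(8/h³) / (1 + ((r-s)/h)²)`. By
disjointness these integrals sum to at most the integral over the line, `8π/h² ≤ 32/h²`. -/
theorem sum_inv_sq_le {ι : Type*} (J : Finset ι) (x ρ : ι → ℝ) (E : ι → Set ℝ)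
    (hρ : ∀ i ∈ J, 0 < ρ i) (hE : ∀ i ∈ J, MeasurableSet (E i))
    (hdisj : (J : Set ι).PairwiseDisjoint E)
    (hsub : ∀ i ∈ J, E i ⊆ Ioc (x i) (x i + ρ i)) (hvol : ∀ i ∈ J, ρ i / 4 ≤ volume.real (E i))
    {s t : ℝ} (hst : s ≠ t) (hs : ∀ i ∈ J, s ∈ Ioc (x i) (x i + ρ i))
    (ht : ∀ i ∈ J, t ∈ Ioc (x i) (x i + ρ i)) :
    ∑ i ∈ J, ENNReal.ofReal (1 / ρ i ^ 2) ≤ 32 * ENNReal.ofReal (1 / (s - t) ^ 2) := by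
  set h := |s - t| with hh
  have hpos : 0 < h := abs_pos.2 (sub_ne_zero.2 hst)
  have hterm : ∀ i ∈ J, ENNReal.ofReal (1 / ρ i ^ 2) ≤
      ∫⁻ r in E i, ENNReal.ofReal (8 / h ^ 3) * ENNReal.ofReal ((1 + ((r - s) / h) ^ 2)⁻¹) := by
    intro i hi
    have hρi := hρ i hi
    have hfin : volume (E i) ≠ ∞ := ((measure_mono (hsub i hi)).trans_lt (by simp)).ne
    calc ENNReal.ofReal (1 / ρ i ^ 2)
        ≤ ENNReal.ofReal (4 / ρ i ^ 3) * volume (E i) := by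
          rw [← ofReal_measureReal hfin, ← ENNReal.ofReal_mul (by positivity)]
          refine ENNReal.ofReal_le_ofReal ?_
          calc 1 / ρ i ^ 2 = 4 / ρ i ^ 3 * (ρ i / 4) := by field_simp
            _ ≤ _ := by gcongr; exact hvol i hi
      _ = ∫⁻ r in E i, ENNReal.ofReal (4 / ρ i ^ 3) := by rw [setLIntegral_const]
      _ ≤ _ := by
          refine setLIntegral_mono' (hE i hi) fun r hr => ?_
          rw [← ENNReal.ofReal_mul (by positivity)]
          refine ENNReal.ofReal_le_ofReal ?_
          have hr' := hsub i hi hr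
          have hs' := hs i hi
          have ht' := ht i hi
          have h1 : h ≤ ρ i := by
            rw [hh, abs_le]; constructor <;> linarith [hs'.1, hs'.2, ht'.1, ht'.2]
          have h2 : |r - s| ≤ ρ i := by
            rw [abs_le]; constructor <;> linarith [hs'.1, hs'.2, hr'.1, hr'.2]
          have h3 : (r - s) ^ 2 ≤ ρ i ^ 2 := sq_le_sq.2 (h2.trans (le_abs_self _))
          have h4 : h ^ 2 ≤ ρ i ^ 2 := by gcongr
          have h5 : h * (h ^ 2 + (r - s) ^ 2) ≤ ρ i * (2 * ρ i ^ 2) := by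
            gcongr; linarith
          rw [div_mul_eq_mul_div, mul_comm, ← div_eq_inv_mul, div_div,
            div_le_div_iff₀ (by positivity) (by positivity)]
          have h6 : (1 + ((r - s) / h) ^ 2) * h ^ 3 = h * (h ^ 2 + (r - s) ^ 2) := by
            field_simp
          rw [h6]
          linarith
  calc ∑ i ∈ J, ENNReal.ofReal (1 / ρ i ^ 2)
      ≤ ∑ i ∈ J, ∫⁻ r in E i,
          ENNReal.ofReal (8 / h ^ 3) * ENNReal.ofReal ((1 + ((r - s) / h) ^ 2)⁻¹) :=
        Finset.sum_le_sum hterm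
    _ = ∫⁻ r in ⋃ i ∈ J, E i,
          ENNReal.ofReal (8 / h ^ 3) * ENNReal.ofReal ((1 + ((r - s) / h) ^ 2)⁻¹) :=
        (lintegral_biUnion_finset hdisj hE _).symm
    _ ≤ ∫⁻ r, ENNReal.ofReal (8 / h ^ 3) * ENNReal.ofReal ((1 + ((r - s) / h) ^ 2)⁻¹) :=
        setLIntegral_le_lintegral _ _
    _ = ENNReal.ofReal (8 / h ^ 3 * (h * Real.pi)) := by
        rw [lintegral_const_mul' _ _ ENNReal.ofReal_ne_top, lintegral_inv_one_add_sq_comp hpos,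
          ← ENNReal.ofReal_mul (by positivity)]
    _ ≤ ENNReal.ofReal (32 * (1 / h ^ 2)) := by
        refine ENNReal.ofReal_le_ofReal ?_
        have : 8 / h ^ 3 * (h * Real.pi) = 8 * Real.pi * (1 / h ^ 2) := by field_simp
        rw [this]
        gcongr
        linarith [Real.pi_le_four]
    _ = 32 * ENNReal.ofReal (1 / (s - t) ^ 2) := by
        rw [ENNReal.ofReal_mul (by norm_num), hh, sq_abs]
        norm_num

/-! ### The energy of a function of one variable -/

/-- The integrand `1_{|g(s) - g(t)| > δ} / |s - t|²`. -/
def jumpKernel (g : ℝ → ℝ) (δ : ℝ) (p : ℝ × ℝ) : ℝ≥0∞ :=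
  if δ < |g p.1 - g p.2| then ENNReal.ofReal (1 / (p.1 - p.2) ^ 2) else 0

theorem le_lintegral_window {A D : Set ℝ} {x ρ : ℝ} (hρ : 0 < ρ)
    (hA : ρ / 4 ≤ volume.real (A ∩ Ioc x (x + ρ)))
    (hD : ρ / 4 ≤ volume.real (D ∩ Ioc x (x + ρ))) :
    ENNReal.ofReal (1 / 16) ≤
      ∫⁻ _ in (A ∩ Ioc x (x + ρ)) ×ˢ (D ∩ Ioc x (x + ρ)),
        ENNReal.ofReal (1 / ρ ^ 2) ∂(volume : Measure (ℝ × ℝ)) := by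
  have hfin : ∀ A : Set ℝ, volume (A ∩ Ioc x (x + ρ)) ≠ ∞ := fun A =>
    (measure_inter_lt_top_of_right_ne_top (by simp)).ne
  rw [setLIntegral_const, Measure.volume_eq_prod, Measure.prod_prod,
    ← ofReal_measureReal (hfin A), ← ofReal_measureReal (hfin D),
    ← ENNReal.ofReal_mul measureReal_nonneg, ← ENNReal.ofReal_mul (by positivity)]
  refine ENNReal.ofReal_le_ofReal ?_
  calc (1 / 16 : ℝ) = 1 / ρ ^ 2 * (ρ / 4 * (ρ / 4)) := by field_simp; norm_num
    _ ≤ _ := by gcongr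

theorem ofReal_le_jumpKernel {g : ℝ → ℝ} {δ T : ℝ} (hδ : 0 < δ) {x ρ s t : ℝ}
    (hs : s ∈ {s | g s < T} ∩ Ioc x (x + ρ)) (ht : t ∈ {s | T + δ ≤ g s} ∩ Ioc x (x + ρ)) :
    ENNReal.ofReal (1 / ρ ^ 2) ≤ jumpKernel g δ (s, t) := by
  have h1 : g s < T := hs.1
  have h2 : T + δ ≤ g t := ht.1
  have hlt : δ < |g s - g t| := by
    rw [abs_sub_comm]; exact lt_of_lt_of_le (by linarith) (le_abs_self _)
  have hne : s ≠ t := by rintro rfl; simp at hlt; linarith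
  have hle : (s - t) ^ 2 ≤ ρ ^ 2 := by
    refine sq_le_sq.2 ((abs_le.2 ⟨?_, ?_⟩).trans (le_abs_self _)) <;>
      linarith [hs.2.1, hs.2.2, ht.2.1, ht.2.2]
  rw [jumpKernel, if_pos hlt]
  have : 0 < (s - t) ^ 2 := by have := sub_ne_zero.2 hne; positivity
  exact ENNReal.ofReal_le_ofReal (by gcongr)

/-- Each window carries energy at least `1/16` while its square has area tending to `0`; a finite
integral would violate absolute continuity. -/
theorem lintegral_jumpKernel_eq_top {g : ℝ → ℝ} (hg : Measurable g) {δ T : ℝ} (hδ : 0 < δ)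
    (h : ∀ n : ℕ, ∃ x : ℝ, Ioc x (x + 1 / 4 * (1 / 2) ^ n) ⊆ Ioc 0 1 ∧
      1 / 4 * (1 / 2) ^ n / 4 ≤ volume.real ({s | g s < T} ∩ Ioc x (x + 1 / 4 * (1 / 2) ^ n)) ∧
      1 / 4 * (1 / 2) ^ n / 4 ≤
        volume.real ({s | T + δ ≤ g s} ∩ Ioc x (x + 1 / 4 * (1 / 2) ^ n))) :
    ∫⁻ p in Ioc 0 1 ×ˢ Ioc 0 1, jumpKernel g δ p = ∞ := by
  by_contra hne
  obtain ⟨η, hη, hsmall⟩ := exists_pos_setLIntegral_lt_of_measure_lt hne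
    (ε := ENNReal.ofReal (1 / 16)) (by simp)
  have hlim : Tendsto (fun n : ℕ => ENNReal.ofReal (1 / 4 * (1 / 2) ^ n) *
      ENNReal.ofReal (1 / 4 * (1 / 2) ^ n)) atTop (𝓝 0) := by
    have h1 : Tendsto (fun n : ℕ => (1 / 4 * (1 / 2) ^ n : ℝ)) atTop (𝓝 (1 / 4 * 0)) :=
      (tendsto_pow_atTop_nhds_zero_of_lt_one (by norm_num) (by norm_num)).const_mul _
    have h2 := ENNReal.tendsto_ofReal (h1.mul h1)
    simp only [mul_zero, ENNReal.ofReal_zero] at h2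
    refine h2.congr fun n => ENNReal.ofReal_mul (by positivity)
  obtain ⟨n, hn⟩ := (hlim.eventually (gt_mem_nhds hη)).exists
  obtain ⟨x, hsub, hA, hD⟩ := h n
  have hρ : (0 : ℝ) < 1 / 4 * (1 / 2) ^ n := by positivity
  set ρ : ℝ := 1 / 4 * (1 / 2) ^ n
  have hmW : MeasurableSet (Ioc x (x + ρ) ×ˢ Ioc x (x + ρ)) := measurableSet_Ioc.prod measurableSet_Ioc
  have hlt := hsmall (Ioc x (x + ρ) ×ˢ Ioc x (x + ρ)) (by
    rw [Measure.restrict_apply hmW, inter_eq_self_of_subset_left (prod_mono hsub hsub),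
      Measure.volume_eq_prod, Measure.prod_prod]
    simpa using hn)
  rw [Measure.restrict_restrict hmW, inter_eq_self_of_subset_left (prod_mono hsub hsub)] at hlt
  refine absurd hlt (not_lt.2 ((le_lintegral_window hρ hA hD).trans ?_))
  have hmA : MeasurableSet {s | g s < T} := measurableSet_lt hg measurable_const
  have hmD : MeasurableSet {s | T + δ ≤ g s} := measurableSet_le measurable_const hg
  refine (setLIntegral_mono' ((hmA.inter measurableSet_Ioc).prod (hmD.inter measurableSet_Ioc))
    fun p hp => ofReal_le_jumpKernel hδ hp.1 hp.2).trans ?_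
  exact lintegral_mono_set (prod_mono inter_subset_right inter_subset_right)

/-- Each band contributes `1/16` through a rectangle of pairs in its own window. The factor `32`
pays for overlapping rectangles, by `sum_inv_sq_le` applied to the parts of the windows inside the
bands. -/
theorem card_le_lintegral_jumpKernel {g : ℝ → ℝ} (hg : Measurable g) {δ T : ℝ} (hδ : 0 < δ)
    (J : Finset ℕ)
    (h0 : ∀ i ∈ J, volume.real ({s | T + i * δ + δ ≤ g s} ∩ Ioc 0 (1 / 4)) ≤
      volume.real ({s | g s < T + i * δ} ∩ Ioc 0 (1 / 4)))
    (h1 : ∀ i ∈ J, volume.real ({s | g s < T + i * δ} ∩ Ioc (3 / 4) 1) ≤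
      volume.real ({s | T + i * δ + δ ≤ g s} ∩ Ioc (3 / 4) 1))
    (hB : ∀ i ∈ J,
      volume.real (({s | g s < T + i * δ} ∪ {s | T + i * δ + δ ≤ g s})ᶜ ∩ Ioc 0 1) < 1 / 16) :
    J.card * ENNReal.ofReal (1 / 16) ≤
      32 * ∫⁻ p in Ioc 0 1 ×ˢ Ioc 0 1, jumpKernel g δ p := by
  classical
  set A : ℕ → Set ℝ := fun i => {s | g s < T + i * δ}
  set D : ℕ → Set ℝ := fun i => {s | T + i * δ + δ ≤ g s}
  have hmA : ∀ i, MeasurableSet (A i) := fun i => measurableSet_lt hg measurable_const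
  have hmD : ∀ i, MeasurableSet (D i) := fun i => measurableSet_le measurable_const hg
  have hAD : ∀ i, Disjoint (A i) (D i) := fun i => disjoint_left.2 fun s hs hs' => by
    have h1 : g s < T + i * δ := hs
    have h2 : T + i * δ + δ ≤ g s := hs'
    linarith
  by_cases htop : ∫⁻ p in Ioc 0 1 ×ˢ Ioc 0 1, jumpKernel g δ p = ∞
  · simp [htop]
  have hwin : ∀ i ∈ J, ∃ x ρ : ℝ, 0 < ρ ∧ Ioc x (x + ρ) ⊆ Ioc 0 1 ∧
      ρ / 4 ≤ volume.real (A i ∩ Ioc x (x + ρ)) ∧ ρ / 4 ≤ volume.real (D i ∩ Ioc x (x + ρ)) ∧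
      ρ / 4 ≤ volume.real ((A i ∪ D i)ᶜ ∩ Ioc x (x + ρ)) := fun i hi =>
    (exists_window (hmA i) (hmD i) (hAD i) (h0 i hi) (h1 i hi) (hB i hi)).resolve_right
      fun h => htop (lintegral_jumpKernel_eq_top hg hδ h)
  choose! x ρ hρ hsub hwA hwD hwB using hwin
  set W : ℕ → Set ℝ := fun i => Ioc (x i) (x i + ρ i)
  set R : ℕ → Set (ℝ × ℝ) := fun i => (A i ∩ W i) ×ˢ (D i ∩ W i)
  have hmR : ∀ i, MeasurableSet (R i) := fun i =>
    ((hmA i).inter measurableSet_Ioc).prod ((hmD i).inter measurableSet_Ioc)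
  have hpt : ∀ p : ℝ × ℝ, ∑ i ∈ J, (R i).indicator (fun _ => ENNReal.ofReal (1 / ρ i ^ 2)) p ≤
      (Ioc 0 1 ×ˢ Ioc 0 1).indicator (fun p => 32 * jumpKernel g δ p) p := by
    rintro ⟨s, t⟩
    have hsum : ∑ i ∈ J, (R i).indicator (fun _ => ENNReal.ofReal (1 / ρ i ^ 2)) (s, t) =
        ∑ i ∈ J.filter fun i => (s, t) ∈ R i, ENNReal.ofReal (1 / ρ i ^ 2) := by
      rw [Finset.sum_filter]
      exact Finset.sum_congr rfl fun i _ => by by_cases h : (s, t) ∈ R i <;> simp [h]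
    rw [hsum]
    rcases (J.filter fun i => (s, t) ∈ R i).eq_empty_or_nonempty with he | ⟨j, hj⟩
    · rw [he]; simp
    have hmem : ∀ i ∈ J.filter fun i => (s, t) ∈ R i, i ∈ J ∧ s ∈ A i ∩ W i ∧ t ∈ D i ∩ W i :=
      fun i hi => ⟨(Finset.mem_filter.1 hi).1, (Finset.mem_filter.1 hi).2.1,
        (Finset.mem_filter.1 hi).2.2⟩
    obtain ⟨hjJ, hjs, hjt⟩ := hmem j hj
    have hst : s ≠ t := by
      rintro rfl
      exact disjoint_left.1 (hAD j) hjs.1 hjt.1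
    have hlt : δ < |g s - g t| := by
      have h1 : g s < T + j * δ := hjs.1
      have h2 : T + j * δ + δ ≤ g t := hjt.1
      rw [abs_sub_comm]; exact lt_of_lt_of_le (by linarith) (le_abs_self _)
    rw [indicator_of_mem (mk_mem_prod (hsub j hjJ hjs.2) (hsub j hjJ hjt.2)), jumpKernel,
      if_pos hlt]
    refine sum_inv_sq_le _ x ρ (fun i => (A i ∪ D i)ᶜ ∩ W i) (fun i hi => hρ i (hmem i hi).1)
      (fun i _ => ((hmA i).union (hmD i)).compl.inter measurableSet_Ioc) ?_
      (fun i _ => inter_subset_right) (fun i hi => hwB i (hmem i hi).1) hst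
      (fun i hi => (hmem i hi).2.1.2) (fun i hi => (hmem i hi).2.2.2)
    have hgap : ∀ i r, r ∈ (A i ∪ D i)ᶜ → T + i * δ ≤ g r ∧ g r < T + i * δ + δ := fun i r hr => by
      simpa [A, D, not_or] using hr
    intro i _ k _ hik
    refine disjoint_left.2 fun r hr hr' => hik ?_
    obtain ⟨a1, a2⟩ := hgap i r hr.1
    obtain ⟨b1, b2⟩ := hgap k r hr'.1
    have c1 : (i : ℝ) < k + 1 := lt_of_mul_lt_mul_right (by linarith) hδ.le
    have c2 : (k : ℝ) < i + 1 := lt_of_mul_lt_mul_right (by linarith) hδ.le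
    have c1' : i < k + 1 := by exact_mod_cast c1
    have c2' : k < i + 1 := by exact_mod_cast c2
    omega
  calc J.card * ENNReal.ofReal (1 / 16) = ∑ _i ∈ J, ENNReal.ofReal (1 / 16) := by
        rw [Finset.sum_const, nsmul_eq_mul]
    _ ≤ ∑ i ∈ J, ∫⁻ p, (R i).indicator (fun _ => ENNReal.ofReal (1 / ρ i ^ 2)) p := by
        refine Finset.sum_le_sum fun i hi => ?_
        rw [lintegral_indicator (hmR i)]
        exact le_lintegral_window (hρ i hi) (hwA i hi) (hwD i hi)
    _ = ∫⁻ p, ∑ i ∈ J, (R i).indicator (fun _ => ENNReal.ofReal (1 / ρ i ^ 2)) p :=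
        (lintegral_finsetSum _ fun i _ => measurable_const.indicator (hmR i)).symm
    _ ≤ ∫⁻ p, (Ioc 0 1 ×ˢ Ioc 0 1).indicator (fun p => 32 * jumpKernel g δ p) p :=
        lintegral_mono hpt
    _ = 32 * ∫⁻ p in Ioc 0 1 ×ˢ Ioc 0 1, jumpKernel g δ p := by
        rw [lintegral_indicator (measurableSet_Ioc.prod measurableSet_Ioc),
          lintegral_const_mul' _ _ (by simp)]

/-- A function close to an affine function of slope `β` in `L¹(0, 1)` has energy at least a
multiple of `β`. -/
theorem le_energy_add_lintegral {g : ℝ → ℝ} (hg : Measurable g) {α β δ : ℝ} (hδ : 0 < δ)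
    (hδβ : δ ≤ β / 136) :
    ENNReal.ofReal (β / 4096) ≤
      ENNReal.ofReal δ * (∫⁻ p in Ioc 0 1 ×ˢ Ioc 0 1, jumpKernel g δ p) +
        ∫⁻ s in Ioc 0 1, ‖g s - (α + β * s)‖ₑ := by
  have hβ : 0 < β := by linarith
  -- If the `L¹` distance exceeds `β/128`, it alone gives the bound. Otherwise Markov's inequality
  -- at height `β/8` leaves an exceptional set of measure at most `1/16`.
  by_cases hL : ∫⁻ s in Ioc 0 1, ‖g s - (α + β * s)‖ₑ ≤ ENNReal.ofReal (β / 128)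
  swap
  · refine le_add_left ((ENNReal.ofReal_le_ofReal ?_).trans (not_le.1 hL).le)
    linarith
  refine le_add_right ?_
  -- the set where `g` is far from the affine function is small
  set X : Set ℝ := {s | β / 8 ≤ |g s - (α + β * s)|}
  have hmX : MeasurableSet X := measurableSet_le measurable_const (by fun_prop)
  have hXe : volume (X ∩ Ioc 0 1) ≤ ENNReal.ofReal (1 / 16) := by
    have h1 := mul_meas_ge_le_lintegral (μ := volume.restrict (Ioc (0 : ℝ) 1))
      (f := fun s => ‖g s - (α + β * s)‖ₑ) (by fun_prop) (ENNReal.ofReal (β / 8))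
    have hX : {s | ENNReal.ofReal (β / 8) ≤ ‖g s - (α + β * s)‖ₑ} = X := by
      ext s
      rw [mem_ofPred_eq, mem_ofPred_eq, Real.enorm_eq_ofReal_abs, ENNReal.ofReal_le_ofReal_iff (abs_nonneg _)]
    rw [hX, Measure.restrict_apply hmX] at h1
    have h2 := h1.trans hL
    rw [show β / 128 = β / 8 * (1 / 16) by ring, ENNReal.ofReal_mul (by positivity)] at h2
    exact (ENNReal.mul_le_mul_iff_right (by simpa using hβ) ENNReal.ofReal_ne_top).1 h2
  have hX16 : volume.real (X ∩ Ioc 0 1) ≤ 1 / 16 :=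
    ENNReal.toReal_le_of_le_ofReal (by norm_num) hXe
  have hfin : ∀ (S : Set ℝ) (a b : ℝ), volume (S ∩ Ioc a b) ≠ ∞ := fun S a b =>
    (measure_inter_lt_top_of_right_ne_top measure_Ioc_lt_top.ne).ne
  -- comparing two sets on an interval where they are determined outside `X`
  have hcmp : ∀ (S S' : Set ℝ) (a b : ℝ), 0 ≤ a → b ≤ 1 → b - a = 1 / 4 →
      (∀ s ∈ Ioc a b, s ∉ X → s ∈ S ∧ s ∉ S') →
      volume.real (S' ∩ Ioc a b) ≤ volume.real (S ∩ Ioc a b) := by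
    intro S S' a b ha hb hab h
    have hsub : Ioc a b ⊆ Ioc 0 1 := Ioc_subset_Ioc ha hb
    have h1 : volume.real (S' ∩ Ioc a b) ≤ volume.real (X ∩ Ioc 0 1) :=
      measureReal_mono (fun s hs => ⟨by_contra fun hX => (h s hs.2 hX).2 hs.1, hsub hs.2⟩)
        (hfin _ _ _)
    have h2 : volume.real (Ioc a b) ≤
        volume.real ((S ∩ Ioc a b) ∪ (X ∩ Ioc 0 1)) :=
      measureReal_mono (fun s hs => by
        by_cases hX : s ∈ X
        · exact Or.inr ⟨hX, hsub hs⟩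
        · exact Or.inl ⟨(h s hs hX).1, hs⟩)
        (measure_union_ne_top (hfin _ _ _) (hfin _ _ _))
    have h3 := measureReal_union_le (μ := volume) (S ∩ Ioc a b) (X ∩ Ioc 0 1)
    rw [Real.volume_real_Ioc_of_le (by linarith), hab] at h2
    linarith
  -- Off `X`, `g` is below `α + β/4 + β/8 = T` on the first quarter and above `α + 3β/4 - β/8 = T +
  -- β/4` on the last. The `N` bands of height `δ` fit between these two values.
  set T : ℝ := α + 3 * β / 8
  set N : ℕ := ⌊β / (4 * δ)⌋₊
  have hNδ : N * δ ≤ β / 4 := by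
    have h1 : (N : ℝ) ≤ β / (4 * δ) := Nat.floor_le (by positivity)
    calc N * δ ≤ β / (4 * δ) * δ := by gcongr
      _ = β / 4 := by field_simp
  set B : ℕ → Set ℝ := fun i => ({s | g s < T + i * δ} ∪ {s | T + i * δ + δ ≤ g s})ᶜ
  have hmB : ∀ i, MeasurableSet (B i) := fun i =>
    ((measurableSet_lt hg measurable_const).union (measurableSet_le measurable_const hg)).compl
  have hgap : ∀ i r, r ∈ B i → T + i * δ ≤ g r ∧ g r < T + i * δ + δ := fun i r hr => by
    simpa [B, not_or] using hr
  have hBd : Pairwise (Function.onFun Disjoint B) := by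
    intro i k hik
    refine disjoint_left.2 fun r hr hr' => hik ?_
    obtain ⟨a1, a2⟩ := hgap i r hr
    obtain ⟨b1, b2⟩ := hgap k r hr'
    have c1 : (i : ℝ) < k + 1 := lt_of_mul_lt_mul_right (by linarith) hδ.le
    have c2 : (k : ℝ) < i + 1 := lt_of_mul_lt_mul_right (by linarith) hδ.le
    have c1' : i < k + 1 := by exact_mod_cast c1
    have c2' : k < i + 1 := by exact_mod_cast c2
    omega
  set J : Finset ℕ := (Finset.range N).filter fun i => volume.real (B i ∩ Ioc 0 1) < 1 / 16
  -- The bands have disjoint preimages in an interval of length `1`, so at most 16 of them have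
  -- measure at least `1/16`.
  have hJ : ((Finset.range N).filter fun i => ¬ volume.real (B i ∩ Ioc 0 1) < 1 / 16).card ≤ 16 := by
    set J' := (Finset.range N).filter fun i => ¬ volume.real (B i ∩ Ioc 0 1) < 1 / 16
    have h1 : volume.real (⋃ i ∈ J', B i ∩ Ioc 0 1) = ∑ i ∈ J', volume.real (B i ∩ Ioc 0 1) :=
      measureReal_biUnion_finset (fun i _ k _ hik => (hBd hik).mono inter_subset_left
        inter_subset_left) (fun i _ => (hmB i).inter measurableSet_Ioc) (fun i _ => hfin _ _ _)
    have h2 : volume.real (⋃ i ∈ J', B i ∩ Ioc 0 1) ≤ volume.real (Ioc (0 : ℝ) 1) :=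
      measureReal_mono (iUnion₂_subset fun i _ => inter_subset_right) measure_Ioc_lt_top.ne
    have h3 : (J'.card : ℝ) * (1 / 16) ≤ ∑ i ∈ J', volume.real (B i ∩ Ioc 0 1) := by
      rw [← nsmul_eq_mul]
      exact Finset.card_nsmul_le_sum _ _ _ fun i hi => not_lt.1 (Finset.mem_filter.1 hi).2
    rw [h1, Real.volume_real_Ioc_of_le (by norm_num)] at h2
    have h4 : (J'.card : ℝ) ≤ 16 := by linarith
    exact_mod_cast h4
  have hcard : β / (8 * δ) ≤ J.card := by
    have h1 := Finset.card_filter_add_card_filter_not (s := Finset.range N)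
      fun i => volume.real (B i ∩ Ioc 0 1) < 1 / 16
    rw [Finset.card_range] at h1
    change J.card + _ = N at h1
    have h2 : (N : ℝ) ≤ J.card + 16 := by
      have : N ≤ J.card + 16 := by omega
      exact_mod_cast this
    have h3 : β / (4 * δ) < N + 1 := Nat.lt_floor_add_one _
    -- This is where `136 = 8 * 17` is used: 16 discarded bands and one lost to the floor cost at
    -- most half of `β/(4δ)`.
    have h4 : 17 ≤ β / (8 * δ) := by rw [le_div_iff₀ (by positivity)]; linarith
    have h5 : β / (4 * δ) = 2 * (β / (8 * δ)) := by field_simp; norm_num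
    linarith
  have hfar : ∀ s, s ∉ X → α + β * s - β / 8 < g s ∧ g s < α + β * s + β / 8 := fun s hs => by
    have := abs_lt.1 (not_le.1 (show ¬ β / 8 ≤ |g s - (α + β * s)| from hs))
    constructor <;> linarith [this.1, this.2]
  have hiN : ∀ i ∈ J, (i : ℝ) * δ + δ ≤ β / 4 := fun i hi => by
    have h1 : i + 1 ≤ N := Finset.mem_range.1 (Finset.mem_filter.1 hi).1
    have h2 : (i + 1 : ℝ) ≤ N := by exact_mod_cast h1
    calc (i : ℝ) * δ + δ = (i + 1) * δ := by ring
      _ ≤ N * δ := by gcongr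
      _ ≤ _ := hNδ
  have key := card_le_lintegral_jumpKernel hg hδ (T := T) J
    (fun i hi => hcmp _ _ 0 (1 / 4) le_rfl (by norm_num) (by norm_num) fun s hs hX => by
      have h1 := (hfar s hX).2
      have h2 : β * s ≤ β * (1 / 4) := by gcongr; exact hs.2
      have h3 : 0 ≤ (i : ℝ) * δ := by positivity
      have h4 : g s < T + i * δ := by simp only [T]; linarith
      exact ⟨h4, fun h5 : T + i * δ + δ ≤ g s => by linarith⟩)
    (fun i hi => hcmp _ _ (3 / 4) 1 (by norm_num) le_rfl (by norm_num) fun s hs hX => by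
      have h1 := (hfar s hX).1
      have h2 : β * (3 / 4) ≤ β * s := by gcongr; exact hs.1.le
      have h3 := hiN i hi
      have h4 : T + i * δ + δ ≤ g s := by simp only [T]; linarith
      exact ⟨h4, fun h5 : g s < T + i * δ => by linarith⟩)
    (fun i hi => (Finset.mem_filter.1 hi).2)
  have h32 : (32 : ℝ≥0∞) * ENNReal.ofReal (β / 4096) ≤
      32 * (ENNReal.ofReal δ * ∫⁻ p in Ioc 0 1 ×ˢ Ioc 0 1, jumpKernel g δ p) := by
    calc (32 : ℝ≥0∞) * ENNReal.ofReal (β / 4096)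
        = ENNReal.ofReal δ * (ENNReal.ofReal (β / (8 * δ)) * ENNReal.ofReal (1 / 16)) := by
          rw [← ENNReal.ofReal_mul (by positivity), ← ENNReal.ofReal_mul (by positivity),
            show (32 : ℝ≥0∞) = ENNReal.ofReal 32 by norm_num, ← ENNReal.ofReal_mul (by norm_num)]
          congr 1
          field_simp
          norm_num
      _ ≤ ENNReal.ofReal δ * (J.card * ENNReal.ofReal (1 / 16)) := by
          gcongr
          exact (ENNReal.ofReal_le_ofReal hcard).trans_eq (ENNReal.ofReal_natCast _)
      _ ≤ ENNReal.ofReal δ * (32 * ∫⁻ p in Ioc 0 1 ×ˢ Ioc 0 1, jumpKernel g δ p) := by gcongr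
      _ = _ := by ring
  exact (ENNReal.mul_le_mul_iff_right (by norm_num) (by norm_num)).1 h32

/-! ### Reduction to lines -/

section Lines

variable {n : ℕ}

theorem lintegral_comp_smul_pi {t : ℝ} (ht : t ≠ 0) {G : (Fin n → ℝ) → ℝ≥0∞} (hG : Measurable G) :
    ∫⁻ θ, G (t • θ) = ENNReal.ofReal (1 / |t| ^ n) * ∫⁻ q, G q := by
  have h := Measure.map_addHaar_smul (volume : Measure (Fin n → ℝ)) ht
  rw [← lintegral_map hG (measurable_const_smul t), h, lintegral_smul_measure,
    Module.finrank_fin_fun, abs_inv, abs_pow, smul_eq_mul, one_div]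

/-- The change of variables `(p, q) = (z + s θ, z + t θ)`. -/
theorem lintegral_lintegral_line {G : (Fin n → ℝ) × (Fin n → ℝ) → ℝ≥0∞} (hG : Measurable G)
    {s t : ℝ} (hst : s ≠ t) :
    ∫⁻ z, ∫⁻ θ, G (z + s • θ, z + t • θ) =
      ENNReal.ofReal (1 / |s - t| ^ n) * ∫⁻ p, ∫⁻ q, G (p, q) := by
  rw [lintegral_lintegral_swap (by
    exact (hG.comp (by fun_prop : Measurable fun x : (Fin n → ℝ) × (Fin n → ℝ) =>
      (x.1 + s • x.2, x.1 + t • x.2))).aemeasurable)]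
  have h1 : ∀ θ : Fin n → ℝ, ∫⁻ z, G (z + s • θ, z + t • θ) = ∫⁻ p, G (p, p + (t - s) • θ) := by
    intro θ
    rw [← lintegral_add_right_eq_self (fun p => G (p, p + (t - s) • θ)) (s • θ)]
    refine lintegral_congr fun z => ?_
    rw [sub_smul, add_assoc, add_sub_cancel]
  simp_rw [h1]
  rw [lintegral_lintegral_swap (by
    exact (hG.comp (by fun_prop : Measurable fun x : (Fin n → ℝ) × (Fin n → ℝ) =>
      (x.2, x.2 + (t - s) • x.1))).aemeasurable)]
  have h2 : ∀ p : Fin n → ℝ, ∫⁻ θ, G (p, p + (t - s) • θ) =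
      ENNReal.ofReal (1 / |s - t| ^ n) * ∫⁻ q, G (p, q) := by
    intro p
    rw [lintegral_comp_smul_pi (sub_ne_zero.2 hst.symm) (G := fun w => G (p, p + w))
      (hG.comp (by fun_prop)), abs_sub_comm, lintegral_add_left_eq_self (fun q => G (p, q)) p]
  simp_rw [h2]
  rw [lintegral_const_mul' _ _ ENNReal.ofReal_ne_top]

/-- The integrand `1_{|f(a) - f(b)| > δ} / |a - b|^(n+2)` on `ℝ × ℝⁿ`, with the sup distance. -/
def prodKernel (f : ℝ × (Fin n → ℝ) → ℝ) (δ : ℝ) (a b : ℝ × (Fin n → ℝ)) : ℝ≥0∞ :=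
  if δ < |f a - f b| then (edist a b ^ (n + 2))⁻¹ else 0

theorem measurable_prodKernel {f : ℝ × (Fin n → ℝ) → ℝ} (hf : Measurable f) (δ : ℝ) :
    Measurable fun x : (ℝ × (Fin n → ℝ)) × (ℝ × (Fin n → ℝ)) => prodKernel f δ x.1 x.2 := by
  refine Measurable.ite (measurableSet_lt measurable_const (by fun_prop)) ?_ measurable_const
  exact ((measurable_fst.edist measurable_snd).pow_const _).inv

theorem add_smul_mem_Icc {z θ : Fin n → ℝ} (hz : z ∈ Icc (0 : Fin n → ℝ) (fun _ => 1 / 2))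
    (hθ : θ ∈ Icc (0 : Fin n → ℝ) (fun _ => 1 / 2)) {s : ℝ} (hs : s ∈ Icc (0 : ℝ) 1) :
    z + s • θ ∈ Icc (0 : Fin n → ℝ) 1 := by
  refine ⟨fun i => ?_, fun i => ?_⟩
  · have h1 := hz.1 i; have h2 := hθ.1 i
    simp only [Pi.zero_apply, Pi.add_apply, Pi.smul_apply, smul_eq_mul] at *
    have := mul_nonneg hs.1 h2
    linarith
  · have h1 := hz.2 i; have h2 := hθ.2 i; have h3 := hθ.1 i
    simp only [Pi.zero_apply, Pi.one_apply, Pi.add_apply, Pi.smul_apply, smul_eq_mul] at *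
    have : s * θ i ≤ 1 * (1 / 2) := mul_le_mul hs.2 h2 h3 (by norm_num)
    linarith

/-- For fixed `s ≠ t`, pass from `(z, θ)` to the endpoints `(p, q)`. As `0 ≤ θ i ≤ 1/2`, the sup
distance between `(s, p)` and `(t, q)` is `|s - t|`, so kernel times Jacobian is the inverse power
`n + 2` of that distance. -/
theorem lintegral_lintegral_jumpKernel_le {f : ℝ × (Fin n → ℝ) → ℝ} (hf : Measurable f) {δ : ℝ}
    (hδ : 0 < δ) {s t : ℝ} (hs : s ∈ Icc (0 : ℝ) 1) (ht : t ∈ Icc (0 : ℝ) 1) :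
    ∫⁻ z in Icc (0 : Fin n → ℝ) (fun _ => 1 / 2), ∫⁻ θ in Icc (0 : Fin n → ℝ) (fun _ => 1 / 2),
      jumpKernel (fun s => f (s, z + s • θ)) δ (s, t) ≤
    ∫⁻ p in Icc (0 : Fin n → ℝ) 1, ∫⁻ q in Icc (0 : Fin n → ℝ) 1,
      prodKernel f δ (s, p) (t, q) := by
  rcases eq_or_ne s t with rfl | hst
  · simp [jumpKernel, hδ.not_gt]
  have hpos : 0 < |s - t| := abs_pos.2 (sub_ne_zero.2 hst)
  set C : Set (Fin n → ℝ) := Icc 0 1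
  -- The distance condition holds for endpoints of the chosen segments, and it must be recorded:
  -- after the change of variables `p` and `q` range freely.
  set S : Set ((Fin n → ℝ) × (Fin n → ℝ)) :=
    (C ×ˢ C) ∩ {x | edist x.1 x.2 ≤ edist s t} ∩ {x | δ < |f (s, x.1) - f (t, x.2)|}
  have hS : MeasurableSet S :=
    ((measurableSet_Icc.prod measurableSet_Icc).inter (measurableSet_le (by fun_prop)
      measurable_const)).inter (measurableSet_lt measurable_const (by fun_prop))
  set G : (Fin n → ℝ) × (Fin n → ℝ) → ℝ≥0∞ :=
    S.indicator fun _ => ENNReal.ofReal (1 / (s - t) ^ 2)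
  have hG : Measurable G := measurable_const.indicator hS
  have hle : ∀ z ∈ Icc (0 : Fin n → ℝ) (fun _ => 1 / 2),
      ∀ θ ∈ Icc (0 : Fin n → ℝ) (fun _ => 1 / 2),
      jumpKernel (fun s => f (s, z + s • θ)) δ (s, t) ≤ G (z + s • θ, z + t • θ) := by
    intro z hz θ hθ
    by_cases h : δ < |f (s, z + s • θ) - f (t, z + t • θ)|
    · have hed : edist (z + s • θ) (z + t • θ) ≤ edist s t := by
        rw [edist_pi_le_iff]
        intro i
        have h2 := hθ.2 i; have h3 := hθ.1 i
        rw [edist_dist, edist_dist, Real.dist_eq, Real.dist_eq]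
        refine ENNReal.ofReal_le_ofReal ?_
        simp only [Pi.zero_apply, Pi.add_apply, Pi.smul_apply, smul_eq_mul] at *
        rw [add_sub_add_left_eq_sub, ← sub_mul, abs_mul, abs_of_nonneg h3]
        exact mul_le_of_le_one_right (abs_nonneg _) (by linarith)
      have hmem : (z + s • θ, z + t • θ) ∈ S :=
        ⟨⟨⟨add_smul_mem_Icc hz hθ hs, add_smul_mem_Icc hz hθ ht⟩, hed⟩, h⟩
      rw [jumpKernel, if_pos h]
      simp only [G, indicator_of_mem hmem]
      exact le_rfl
    · rw [jumpKernel, if_neg h]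
      exact zero_le
  have hG2 : ∀ p q, ENNReal.ofReal (1 / |s - t| ^ n) * G (p, q) ≤
      C.indicator (fun p => C.indicator (fun q => prodKernel f δ (s, p) (t, q)) q) p := by
    intro p q
    by_cases h : (p, q) ∈ S
    · simp only [G, indicator_of_mem h]
      have hlt : δ < |f (s, p) - f (t, q)| := h.2
      rw [indicator_of_mem h.1.1.1, indicator_of_mem h.1.1.2, prodKernel, if_pos hlt,
        ← ENNReal.ofReal_mul (by positivity)]
      have hed : edist (s, p) (t, q) ≤ ENNReal.ofReal |s - t| := by
        rw [← Real.dist_eq, ← edist_dist, Prod.edist_eq]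
        exact max_le le_rfl h.1.2
      have h1 : 1 / |s - t| ^ n * (1 / (s - t) ^ 2) = (|s - t| ^ (n + 2))⁻¹ := by
        rw [pow_add, sq_abs]; field_simp
      rw [h1, ENNReal.ofReal_inv_of_pos (by positivity), ENNReal.inv_le_inv,
        ENNReal.ofReal_pow hpos.le]
      gcongr
    · simp only [G, indicator_of_notMem h, mul_zero]
      exact zero_le
  calc _ ≤ ∫⁻ z in Icc (0 : Fin n → ℝ) (fun _ => 1 / 2),
        ∫⁻ θ in Icc (0 : Fin n → ℝ) (fun _ => 1 / 2), G (z + s • θ, z + t • θ) :=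
        setLIntegral_mono' measurableSet_Icc fun z hz =>
          setLIntegral_mono' measurableSet_Icc fun θ hθ => hle z hz θ hθ
    _ ≤ ∫⁻ z, ∫⁻ θ, G (z + s • θ, z + t • θ) :=
        (setLIntegral_le_lintegral _ _).trans
          (lintegral_mono fun z => setLIntegral_le_lintegral _ _)
    _ = ∫⁻ p, ∫⁻ q, ENNReal.ofReal (1 / |s - t| ^ n) * G (p, q) := by
        rw [lintegral_lintegral_line hG hst]
        simp_rw [lintegral_const_mul' _ _ ENNReal.ofReal_ne_top]
    _ ≤ ∫⁻ p, ∫⁻ q,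
          C.indicator (fun p => C.indicator (fun q => prodKernel f δ (s, p) (t, q)) q) p :=
        lintegral_mono fun p => lintegral_mono fun q => hG2 p q
    _ = _ := by
        rw [← lintegral_indicator (s := C) measurableSet_Icc]
        refine lintegral_congr fun p => ?_
        by_cases hp : p ∈ C
        · simp only [indicator_of_mem hp]
          rw [lintegral_indicator measurableSet_Icc]
        · simp only [indicator_of_notMem hp, lintegral_zero]

theorem lintegral_prod_prod_comm {α β : Type*} [MeasurableSpace α] [MeasurableSpace β]
    {μ : Measure α} {ν : Measure β} [SFinite μ] [SFinite ν] {h : (α × β) × (α × β) → ℝ≥0∞}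
    (hh : Measurable h) :
    ∫⁻ a, ∫⁻ b, h (a, b) ∂(μ.prod ν) ∂(μ.prod ν) =
      ∫⁻ c, ∫⁻ p, ∫⁻ q, h ((c.1, p), (c.2, q)) ∂ν ∂ν ∂(μ.prod μ) := by
  have h1 : ∀ a, ∫⁻ b, h (a, b) ∂(μ.prod ν) = ∫⁻ t, ∫⁻ q, h (a, (t, q)) ∂ν ∂μ := fun a =>
    lintegral_prod _ (hh.comp (by fun_prop)).aemeasurable
  have m1 : Measurable fun x : (α × β) × α => ∫⁻ q, h (x.1, (x.2, q)) ∂ν :=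
    (hh.comp (by fun_prop : Measurable fun y : ((α × β) × α) × β =>
      (y.1.1, (y.1.2, y.2)))).lintegral_prod_right'
  simp_rw [h1]
  rw [lintegral_prod _ m1.lintegral_prod_right'.aemeasurable, lintegral_prod]
  · refine lintegral_congr fun s => ?_
    rw [lintegral_lintegral_swap]
    exact (m1.comp (by fun_prop : Measurable fun x : β × α => ((s, x.1), x.2))).aemeasurable
  · have m2 : Measurable fun x : (α × α) × β => ∫⁻ q, h ((x.1.1, x.2), (x.1.2, q)) ∂ν :=
      m1.comp (by fun_prop : Measurable fun x : (α × α) × β => ((x.1.1, x.2), x.1.2))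
    exact m2.lintegral_prod_right'.aemeasurable

theorem measurable_jumpKernel_line {f : ℝ × (Fin n → ℝ) → ℝ} (hf : Measurable f) (δ : ℝ) :
    Measurable fun x : ((Fin n → ℝ) × (Fin n → ℝ)) × (ℝ × ℝ) =>
      jumpKernel (fun s => f (s, x.1.1 + s • x.1.2)) δ x.2 := by
  refine Measurable.ite (measurableSet_lt measurable_const ?_) (by fun_prop) measurable_const
  have h1 : Measurable fun x : ((Fin n → ℝ) × (Fin n → ℝ)) × (ℝ × ℝ) =>
    f (x.2.1, x.1.1 + x.2.1 • x.1.2) := hf.comp (by fun_prop)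
  have h2 : Measurable fun x : ((Fin n → ℝ) × (Fin n → ℝ)) × (ℝ × ℝ) =>
    f (x.2.2, x.1.1 + x.2.2 • x.1.2) := hf.comp (by fun_prop)
  exact (continuous_abs.measurable).comp (h1.sub h2)

/-- The energies of `f` along lines are controlled by the energy of `f`. -/
theorem lintegral_energy_line_le {f : ℝ × (Fin n → ℝ) → ℝ} (hf : Measurable f) {δ : ℝ}
    (hδ : 0 < δ) :
    ∫⁻ z in Icc (0 : Fin n → ℝ) (fun _ => 1 / 2), ∫⁻ θ in Icc (0 : Fin n → ℝ) (fun _ => 1 / 2),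
      ∫⁻ c in Ioc 0 1 ×ˢ Ioc 0 1, jumpKernel (fun s => f (s, z + s • θ)) δ c ≤
    ∫⁻ a in Icc (0 : ℝ) 1 ×ˢ Icc (0 : Fin n → ℝ) 1, ∫⁻ b in Icc (0 : ℝ) 1 ×ˢ Icc (0 : Fin n → ℝ) 1,
      prodKernel f δ a b := by
  have hm := measurable_jumpKernel_line hf δ
  set P : Set (Fin n → ℝ) := Icc 0 (fun _ => 1 / 2)
  calc _ ≤ ∫⁻ z in P, ∫⁻ θ in P, ∫⁻ c in Icc 0 1 ×ˢ Icc 0 1,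
        jumpKernel (fun s => f (s, z + s • θ)) δ c :=
        lintegral_mono fun z => lintegral_mono fun θ =>
          lintegral_mono_set (prod_mono Ioc_subset_Icc_self Ioc_subset_Icc_self)
    _ = ∫⁻ z in P, ∫⁻ c in Icc 0 1 ×ˢ Icc 0 1, ∫⁻ θ in P,
        jumpKernel (fun s => f (s, z + s • θ)) δ c := by
        refine lintegral_congr fun z => ?_
        rw [lintegral_lintegral_swap]
        exact (hm.comp (by fun_prop : Measurable fun x : (Fin n → ℝ) × (ℝ × ℝ) =>
          ((z, x.1), x.2))).aemeasurable
    _ = ∫⁻ c in Icc 0 1 ×ˢ Icc 0 1, ∫⁻ z in P, ∫⁻ θ in P,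
        jumpKernel (fun s => f (s, z + s • θ)) δ c := by
        rw [lintegral_lintegral_swap]
        exact (hm.comp (by fun_prop : Measurable fun x : ((Fin n → ℝ) × (ℝ × ℝ)) × (Fin n → ℝ) =>
          ((x.1.1, x.2), x.1.2))).lintegral_prod_right'.aemeasurable
    _ ≤ ∫⁻ c in Icc 0 1 ×ˢ Icc 0 1, ∫⁻ p in Icc (0 : Fin n → ℝ) 1, ∫⁻ q in Icc (0 : Fin n → ℝ) 1,
        prodKernel f δ (c.1, p) (c.2, q) :=
        setLIntegral_mono' (measurableSet_Icc.prod measurableSet_Icc) fun c hc =>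
          lintegral_lintegral_jumpKernel_le hf hδ hc.1 hc.2
    _ = _ := by
        simp_rw [Measure.volume_eq_prod, ← Measure.prod_restrict]
        exact (lintegral_prod_prod_comm (measurable_prodKernel hf δ)).symm

/-- For fixed `s` and `θ`, the map `z ↦ z + s θ` is a translation into the unit cube, so only the
volume of the set of directions is lost. -/
theorem lintegral_line_le {w : ℝ × (Fin n → ℝ) → ℝ≥0∞} (hw : Measurable w) :
    ∫⁻ z in Icc (0 : Fin n → ℝ) (fun _ => 1 / 2), ∫⁻ θ in Icc (0 : Fin n → ℝ) (fun _ => 1 / 2),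
      ∫⁻ s in Ioc 0 1, w (s, z + s • θ) ≤
    volume (Icc (0 : Fin n → ℝ) (fun _ => 1 / 2)) *
      ∫⁻ a in Icc (0 : ℝ) 1 ×ˢ Icc (0 : Fin n → ℝ) 1, w a := by
  set P : Set (Fin n → ℝ) := Icc 0 (fun _ => 1 / 2)
  have hm : Measurable fun x : ((Fin n → ℝ) × (Fin n → ℝ)) × ℝ => w (x.2, x.1.1 + x.2 • x.1.2) :=
    hw.comp (by fun_prop)
  have hin : ∀ θ ∈ P, ∀ s ∈ Ioc (0 : ℝ) 1, ∫⁻ z in P, w (s, z + s • θ) ≤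
      ∫⁻ p in Icc (0 : Fin n → ℝ) 1, w (s, p) := by
    intro θ hθ s hs
    rw [← lintegral_indicator (s := Icc (0 : Fin n → ℝ) 1) measurableSet_Icc,
      ← lintegral_add_right_eq_self (μ := volume) ((Icc (0 : Fin n → ℝ) 1).indicator _) (s • θ)]
    refine le_trans (setLIntegral_mono' measurableSet_Icc fun z hz => ?_)
      (setLIntegral_le_lintegral P _)
    rw [indicator_of_mem (add_smul_mem_Icc hz hθ (Ioc_subset_Icc_self hs))]
  calc _ = ∫⁻ θ in P, ∫⁻ z in P, ∫⁻ s in Ioc 0 1, w (s, z + s • θ) := by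
        rw [lintegral_lintegral_swap]
        exact hm.lintegral_prod_right'.aemeasurable
    _ = ∫⁻ θ in P, ∫⁻ s in Ioc 0 1, ∫⁻ z in P, w (s, z + s • θ) := by
        refine lintegral_congr fun θ => ?_
        rw [lintegral_lintegral_swap]
        exact (hm.comp (by fun_prop : Measurable fun x : (Fin n → ℝ) × ℝ =>
          ((x.1, θ), x.2))).aemeasurable
    _ ≤ ∫⁻ _ in P, ∫⁻ s in Ioc (0 : ℝ) 1, ∫⁻ p in Icc (0 : Fin n → ℝ) 1, w (s, p) :=
        setLIntegral_mono' measurableSet_Icc fun θ hθ =>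
          setLIntegral_mono' measurableSet_Ioc fun s hs => hin θ hθ s hs
    _ ≤ ∫⁻ _ in P, ∫⁻ s in Icc (0 : ℝ) 1, ∫⁻ p in Icc (0 : Fin n → ℝ) 1, w (s, p) :=
        lintegral_mono fun _ => lintegral_mono_set Ioc_subset_Icc_self
    _ = _ := by
        rw [setLIntegral_const, mul_comm, Measure.volume_eq_prod, ← Measure.prod_restrict,
          lintegral_prod _ hw.aemeasurable]

/-! ### Coordinates on the cube -/

variable (n) in
/-- The identification of `ℝ × ℝⁿ` with `ℝⁿ⁺¹`. -/
def consEquiv : ℝ × (Fin n → ℝ) ≃ᵐ EuclideanSpace ℝ (Fin (n + 1)) :=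
  (MeasurableEquiv.piFinSuccAbove (fun _ => ℝ) 0).symm.trans (MeasurableEquiv.toLp 2 _)

theorem consEquiv_zero (a : ℝ × (Fin n → ℝ)) : consEquiv n a 0 = a.1 := rfl

theorem consEquiv_succ (a : ℝ × (Fin n → ℝ)) (i : Fin n) : consEquiv n a i.succ = a.2 i := rfl

theorem measurePreserving_consEquiv : MeasurePreserving (consEquiv n) :=
  (volume_preserving_piFinSuccAbove (fun _ => ℝ) 0).symm.trans
    (EuclideanSpace.volume_preserving_symm_measurableEquiv_toLp _).symm

theorem preimage_consEquiv_cube :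
    consEquiv n ⁻¹' cube (n + 1) = Icc (0 : ℝ) 1 ×ˢ Icc (0 : Fin n → ℝ) 1 := by
  ext a
  simp only [cube, mem_preimage, mem_ofPred_eq, Fin.forall_fin_succ, consEquiv_zero,
    consEquiv_succ, mem_prod, mem_Icc, Pi.le_def, Pi.zero_apply, Pi.one_apply, forall_and]
  exact and_and_and_comm

theorem setLIntegral_cube (F : EuclideanSpace ℝ (Fin (n + 1)) → ℝ≥0∞) :
    ∫⁻ x in cube (n + 1), F x =
      ∫⁻ a in Icc (0 : ℝ) 1 ×ˢ Icc (0 : Fin n → ℝ) 1, F (consEquiv n a) := by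
  rw [← preimage_consEquiv_cube]
  exact (measurePreserving_consEquiv.setLIntegral_comp_preimage_emb
    (consEquiv n).measurableEmbedding F _).symm

/-- Lets the Euclidean kernel be compared with the sup-distance kernel natural to the line argument,
at the cost of a power of `K`. -/
theorem exists_edist_consEquiv_le (n : ℕ) : ∃ K : ℝ≥0, K ≠ 0 ∧ ∀ a b : ℝ × (Fin n → ℝ),
    edist (consEquiv n a) (consEquiv n b) ≤ K * edist a b := by
  refine ⟨(Fintype.card (Fin (n + 1)) : ℝ≥0) ^ (1 / (2 : ℝ≥0∞)).toReal, ?_, fun a b => (PiLp.antilipschitzWith_ofLp 2 (fun _ : Fin (n + 1) => ℝ)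
    (consEquiv n a) (consEquiv n b)).trans ?_⟩
  · exact (NNReal.rpow_pos (by simp)).ne'
  · gcongr
    rw [edist_pi_le_iff, Fin.forall_fin_succ]
    exact ⟨le_max_left _ _, fun i => (edist_le_pi_edist a.2 b.2 i).trans (le_max_right _ _)⟩

theorem U_consEquiv (s : ℝ) (z θ : Fin n → ℝ) : U (n + 1) (consEquiv n (s, z + s • θ)) =
    (∑ i, z i) / √((n + 1 : ℕ) : ℝ) + (1 + ∑ i, θ i) / √((n + 1 : ℕ) : ℝ) * s := by
  rw [U, Fin.sum_univ_succ]
  simp only [consEquiv_zero, consEquiv_succ, Pi.add_apply, Pi.smul_apply, smul_eq_mul,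
    Finset.sum_add_distrib, ← Finset.mul_sum]
  ring

/-! ### Energy bounds on the cube. -/

theorem lintegral_prodKernel_le {K : ℝ≥0} (hK : K ≠ 0) (hKe : ∀ a b : ℝ × (Fin n → ℝ),
      edist (consEquiv n a) (consEquiv n b) ≤ K * edist a b)
    (v : EuclideanSpace ℝ (Fin (n + 1)) → ℝ) {δ : ℝ} (hδ : 0 < δ) :
    ENNReal.ofReal δ * ∫⁻ a in Icc (0 : ℝ) 1 ×ˢ Icc (0 : Fin n → ℝ) 1,
      ∫⁻ b in Icc (0 : ℝ) 1 ×ˢ Icc (0 : Fin n → ℝ) 1, prodKernel (v ∘ consEquiv n) δ a b ≤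
    (K : ℝ≥0∞) ^ (n + 2) * LamDelta stepFun (cube (n + 1)) δ v := by
  have hK0 : (K : ℝ≥0∞) ^ (n + 2) ≠ 0 := pow_ne_zero _ (ENNReal.coe_ne_zero.2 hK)
  have hKt : (K : ℝ≥0∞) ^ (n + 2) ≠ ∞ := ENNReal.pow_ne_top ENNReal.coe_ne_top
  have hpt : ∀ a b : ℝ × (Fin n → ℝ), prodKernel (v ∘ consEquiv n) δ a b ≤ (K : ℝ≥0∞) ^ (n + 2) *
      ((stepFun ‖v (consEquiv n a) / δ - v (consEquiv n b) / δ‖₊ : ℝ≥0∞) /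
        edist (consEquiv n a) (consEquiv n b) ^ (n + 1 + 1)) := by
    intro a b
    by_cases h : δ < |v (consEquiv n a) - v (consEquiv n b)|
    · have h1 : ¬ ‖v (consEquiv n a) / δ - v (consEquiv n b) / δ‖₊ ≤ 1 := by
        rw [not_le, ← NNReal.coe_lt_coe, coe_nnnorm, ← sub_div, norm_div,
          Real.norm_of_nonneg hδ.le, NNReal.coe_one, one_lt_div hδ]
        exact h
      rw [prodKernel, Function.comp, Function.comp, if_pos h, stepFun, if_neg h1, ENNReal.coe_one, one_div]
      have h2 : edist (consEquiv n a) (consEquiv n b) ^ (n + 2) ≤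
          (K : ℝ≥0∞) ^ (n + 2) * edist a b ^ (n + 2) := by
        rw [← mul_pow]; gcongr; exact hKe a b
      calc (edist a b ^ (n + 2))⁻¹
          = (K : ℝ≥0∞) ^ (n + 2) * ((K : ℝ≥0∞) ^ (n + 2) * edist a b ^ (n + 2))⁻¹ := by
            rw [ENNReal.mul_inv (Or.inl hK0) (Or.inl hKt), ← mul_assoc,
              ENNReal.mul_inv_cancel hK0 hKt, one_mul]
        _ ≤ _ := by gcongr
    · rw [prodKernel]
      simp only [Function.comp, if_neg h]
      exact zero_le
  unfold LamDelta Lam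
  simp_rw [setLIntegral_cube]
  rw [mul_left_comm, ← lintegral_const_mul' _ _ hKt]
  refine mul_le_mul_right (lintegral_mono fun a => ?_) _
  rw [← lintegral_const_mul' _ _ hKt]
  exact lintegral_mono fun b => hpt a b

/-- A quantitative lower bound for the energy near `U`. -/
theorem le_LamDelta_add {K : ℝ≥0} (hK : K ≠ 0) (hKe : ∀ a b : ℝ × (Fin n → ℝ),
      edist (consEquiv n a) (consEquiv n b) ≤ K * edist a b)
    {v : EuclideanSpace ℝ (Fin (n + 1)) → ℝ} (hv : Measurable v) {δ : ℝ} (hδ : 0 < δ)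
    (hδn : δ ≤ 1 / √((n + 1 : ℕ) : ℝ) / 136) :
    ENNReal.ofReal (1 / √((n + 1 : ℕ) : ℝ) / 4096) *
        (volume (Icc (0 : Fin n → ℝ) (fun _ => 1 / 2)) *
          volume (Icc (0 : Fin n → ℝ) (fun _ => 1 / 2))) ≤
      (K : ℝ≥0∞) ^ (n + 2) * LamDelta stepFun (cube (n + 1)) δ v +
        volume (Icc (0 : Fin n → ℝ) (fun _ => 1 / 2)) *
          eLpNorm (v - U (n + 1)) 1 (volume.restrict (cube (n + 1))) := by
  set P : Set (Fin n → ℝ) := Icc 0 (fun _ => 1 / 2)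
  set f : ℝ × (Fin n → ℝ) → ℝ := v ∘ consEquiv n
  have hf : Measurable f := hv.comp (consEquiv n).measurable
  have hU : Measurable (U (n + 1)) := by unfold U; fun_prop
  set w : ℝ × (Fin n → ℝ) → ℝ≥0∞ := fun a => ‖v (consEquiv n a) - U (n + 1) (consEquiv n a)‖ₑ
  have hw : Measurable w := ((hv.sub hU).comp (consEquiv n).measurable).enorm
  set r : ℝ := √((n + 1 : ℕ) : ℝ)
  have hr : 0 < r := Real.sqrt_pos.2 (by positivity)
  have hline : ∀ z ∈ P, ∀ θ ∈ P, ENNReal.ofReal (1 / r / 4096) ≤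
      ENNReal.ofReal δ * (∫⁻ c in Ioc 0 1 ×ˢ Ioc 0 1,
        jumpKernel (fun s => f (s, z + s • θ)) δ c) + ∫⁻ s in Ioc 0 1, w (s, z + s • θ) := by
    -- Since `θ` has nonnegative entries, the slope of `U` along the segment is at least `1/r`,
    -- uniformly in `z` and `θ`.
    intro z _ θ hθ
    have hβ : 1 / r ≤ (1 + ∑ i, θ i) / r := by
      gcongr
      have : 0 ≤ ∑ i, θ i := Finset.sum_nonneg fun i _ => hθ.1 i
      linarith
    have h1 := le_energy_add_lintegral (g := fun s => f (s, z + s • θ)) (hf.comp (by fun_prop))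
      (α := (∑ i, z i) / r) (β := (1 + ∑ i, θ i) / r) hδ (hδn.trans (by gcongr))
    refine (ENNReal.ofReal_le_ofReal (by gcongr)).trans (h1.trans_eq ?_)
    congr 1
    refine lintegral_congr fun s => ?_
    simp only [w, U_consEquiv]
    rfl
  have hm1 : Measurable fun x : (Fin n → ℝ) × (Fin n → ℝ) => ENNReal.ofReal δ *
      (∫⁻ c in Ioc 0 1 ×ˢ Ioc 0 1, jumpKernel (fun s => f (s, x.1 + s • x.2)) δ c) :=
    (measurable_jumpKernel_line hf δ).lintegral_prod_right'.const_mul _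
  calc _ = ∫⁻ _ in P, ∫⁻ _ in P, ENNReal.ofReal (1 / r / 4096) := by
        rw [setLIntegral_const, setLIntegral_const, mul_assoc]
    _ ≤ ∫⁻ z in P, ∫⁻ θ in P, (ENNReal.ofReal δ * (∫⁻ c in Ioc 0 1 ×ˢ Ioc 0 1,
        jumpKernel (fun s => f (s, z + s • θ)) δ c) + ∫⁻ s in Ioc 0 1, w (s, z + s • θ)) :=
        setLIntegral_mono' measurableSet_Icc fun z hz =>
          setLIntegral_mono' measurableSet_Icc fun θ hθ => hline z hz θ hθ
    _ = ENNReal.ofReal δ * (∫⁻ z in P, ∫⁻ θ in P, ∫⁻ c in Ioc 0 1 ×ˢ Ioc 0 1,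
          jumpKernel (fun s => f (s, z + s • θ)) δ c) +
        ∫⁻ z in P, ∫⁻ θ in P, ∫⁻ s in Ioc 0 1, w (s, z + s • θ) := by
        have h1 : ∀ z, ∫⁻ θ in P, (ENNReal.ofReal δ * (∫⁻ c in Ioc 0 1 ×ˢ Ioc 0 1,
            jumpKernel (fun s => f (s, z + s • θ)) δ c) + ∫⁻ s in Ioc 0 1, w (s, z + s • θ)) =
          (∫⁻ θ in P, ENNReal.ofReal δ * (∫⁻ c in Ioc 0 1 ×ˢ Ioc 0 1,
            jumpKernel (fun s => f (s, z + s • θ)) δ c)) +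
          ∫⁻ θ in P, ∫⁻ s in Ioc 0 1, w (s, z + s • θ) := fun z =>
          lintegral_add_left (hm1.comp measurable_prodMk_left) _
        simp_rw [h1]
        rw [lintegral_add_left hm1.lintegral_prod_right']
        simp_rw [lintegral_const_mul' _ _ ENNReal.ofReal_ne_top]
    _ ≤ _ := by
        refine add_le_add ?_ ?_
        · exact (mul_le_mul_right (lintegral_energy_line_le hf hδ) _).trans
            (lintegral_prodKernel_le hK hKe v hδ)
        · refine (lintegral_line_le hw).trans_eq ?_
          rw [eLpNorm_one_eq_lintegral_enorm, setLIntegral_cube]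
          rfl

end Lines

/-! ### Positivity for the step function and the main theorem. -/

theorem kappa_stepFun_pos (d : ℕ) [NeZero d] : 0 < kappa d stepFun := by
  obtain ⟨n, rfl⟩ := Nat.exists_eq_succ_of_ne_zero (NeZero.ne d)
  obtain ⟨K, hK, hKe⟩ := exists_edist_consEquiv_le n
  set V := volume (Icc (0 : Fin n → ℝ) (fun _ => 1 / 2)) with hVdef
  have hV : V = ∏ _i : Fin n, ENNReal.ofReal (1 / 2) := by
    rw [hVdef, Real.volume_Icc_pi]; simp
  have hV0 : V ≠ 0 := by
    rw [hV, Finset.prod_const]; exact pow_ne_zero _ (by simp)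
  have hVt : V ≠ ∞ := by
    rw [hV, Finset.prod_const]; exact ENNReal.pow_ne_top ENNReal.ofReal_ne_top
  have hr : 0 < √((n + 1 : ℕ) : ℝ) := Real.sqrt_pos.2 (by positivity)
  set C : ℝ≥0∞ := ENNReal.ofReal (1 / √((n + 1 : ℕ) : ℝ) / 4096) * (V * V)
  have hC0 : C ≠ 0 := mul_ne_zero (by simp only [ne_eq, ENNReal.ofReal_eq_zero, not_le]; positivity)
    (mul_ne_zero hV0 hV0)
  have hCt : C ≠ ∞ := ENNReal.mul_ne_top ENNReal.ofReal_ne_top (ENNReal.mul_ne_top hVt hVt)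
  have hKt : (K : ℝ≥0∞) ^ (n + 2) ≠ ∞ := ENNReal.pow_ne_top ENNReal.coe_ne_top
  have hK0 : (K : ℝ≥0∞) ^ (n + 2) ≠ 0 := pow_ne_zero _ (ENNReal.coe_ne_zero.2 hK)
  -- Half of `C` absorbs the `L¹` error, which tends to `0` along the family; the other half bounds
  -- the energy from below.
  have hpos : 0 < C / 2 / (K : ℝ≥0∞) ^ (n + 2) :=
    ENNReal.div_pos (ENNReal.half_pos hC0).ne' hKt
  refine hpos.trans_le (le_K_of_measurable fun v _ hvu hm => ?_)
  refine le_liminf_of_le (by isBoundedDefault) ?_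
  have hsmall : ∀ᶠ δ in 𝓝[>] (0 : ℝ),
      V * eLpNorm (v δ - U (n + 1)) 1 (volume.restrict (cube (n + 1))) < C / 2 := by
    have h1 := ENNReal.Tendsto.const_mul hvu (Or.inr hVt)
    rw [mul_zero] at h1
    exact h1.eventually (gt_mem_nhds (ENNReal.half_pos hC0))
  filter_upwards [hsmall, Ioo_mem_nhdsGT (show 0 < 1 / √((n + 1 : ℕ) : ℝ) / 136 by positivity)]
    with δ hδ1 hδ2
  have h1 := le_LamDelta_add hK hKe (hm δ) hδ2.1 hδ2.2.le
  refine ENNReal.div_le_of_le_mul' ?_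
  have h2 : C / 2 + C / 2 ≤
      (K : ℝ≥0∞) ^ (n + 2) * LamDelta stepFun (cube (n + 1)) δ (v δ) + C / 2 := by
    rw [ENNReal.add_halves]
    exact h1.trans (by gcongr)
  exact (ENNReal.add_le_add_iff_right (ENNReal.div_ne_top hCt (by norm_num))).1 h2

end NonlocalTV

end

theorem mainTheorem6 (d : ℕ) [NeZero d] :
    (∀ φ ∈ NonlocalTV.admissible d,
      NonlocalTV.kappa d (NonlocalTV.c1 d • NonlocalTV.stepFun) ≤ NonlocalTV.kappa d φ) ∧
    0 < ⨅ φ ∈ NonlocalTV.admissible d, NonlocalTV.kappa d φ := by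
  refine ⟨fun φ hφ => NonlocalTV.kappa_stepFun_le hφ, ?_⟩
  have hpos : 0 < NonlocalTV.kappa d (NonlocalTV.c1 d • NonlocalTV.stepFun) := by
    have hc := NonlocalTV.coe_c1_ne_zero d
    rw [NonlocalTV.kappa, NonlocalTV.K_smul _ (ENNReal.coe_ne_zero.1 hc)]
    exact ENNReal.mul_pos hc (NonlocalTV.kappa_stepFun_pos d).ne'
  exact hpos.trans_le (le_iInf₂ fun φ hφ => NonlocalTV.kappa_stepFun_le hφ)
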